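/- Let $B_m$ be Artin's braid group on $m$ strands, with words read from left to right. A singularity $X$ has $k$ strands and a local braid $\beta=\beta_1\cdots\beta_r\in B_k$, given as a product of braids. In a braid monodromy process for a curve with $m$ strands, singularities are considered one after another. For each singularity one is given a position $p$ such that, in the fibre close to it, its strands are the consecutive ones $p,\dots,p+k-1$, and a braid $\delta\in B_m$ that relates the fibres on its two sides. For the $j$-th singularity ($j=0,1,2,\dots$) let $\alpha=\delta_{j-1}\cdots\delta_0$. Its factors contribute the braids $\alpha^{-1}\iota_p(\beta_i)\alpha$, where $\iota_p:B_k\to B_m$ puts a braid on the strands $p,\dots,p+k-1$. Let $c$ be the product of these braids in the order $i=1,\dots,r$, and let $T$ be the $k$-element set of global indices of the strands of $X$, i.e. of those strands of the base fibre that $\alpha^{-1}$ carries to the positions $p,\dots,p+k-1$. The strand carried to $p+q$ is said to correspond to the local strand $q$. Suppose that the same singularity $X$ is considered at step $j$ of one process and at step $j'$ of another process on $m$ strands (for instance the same singularities in a different order), with resulting braids $c,c'$ and sets of strands $T,T'$. Then: 1. $c=\alpha^{-1}\iota_p(\beta)\alpha$, and $c$ and $c'$ are conjugate in $B_m$. 2.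 The strands outside $T$ return to their positions under $c$, and deleting the strands of $T$ from $c$ leaves the trivial braid. 3. Deleting from $c$ all strands outside $T$ leaves $\alpha_X^{-1}\beta\,\alpha_X\in B_k$, where $\alpha_X\in B_k$ is what remains of $\alpha$ when only the strands that start in the positions $p,\dots,p+k-1$ are kept. Hence the braids that $c$ and $c'$ induce on $T$ and $T'$ are conjugate in $B_k$. If $k=2$, the induced braid is equal to $\beta$. 4. Two strands in $T$ lie on the same component of the closure of $c$ if and only if the corresponding strands lie on the same component of the closure of $\beta$. The linking numbers of the components of the closure of $c$ that come from $T$ are equal to those of the corresponding components of the closure of $\beta$, and to those of the corresponding components of the closure of $c'$. Each strand outside $T$ closes up to a component that has linking number $0$ with every other component. 5. As an oriented link, the closure of $c$ is isotopic to the closure of $\beta$ together with $m-k$ split unknotted circles. In particular, the closures of $c$ and $c'$ are isotopic. -/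

import Mathlib

/-! ### Artin's braid groups -/

/-- The defining relators of the braid group on `m` strands. The generator with index `i`
(counted from `0`) interchanges the strands in the positions `i` and `i + 1`. -/
def braidRels (m : ℕ) : Set (FreeGroup (Fin (m - 1))) :=
  {r | (∃ i j : Fin (m - 1), (i : ℕ) + 1 < j ∧
          r = FreeGroup.of i * FreeGroup.of j * (FreeGroup.of j * FreeGroup.of i)⁻¹) ∨
       (∃ i j : Fin (m - 1), (i : ℕ) + 1 = j ∧
          r = FreeGroup.of i * FreeGroup.of j * FreeGroup.of i *
            (FreeGroup.of j * FreeGroup.of i * FreeGroup.of j)⁻¹)}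

/-- The braid group on `m` strands. -/
abbrev BraidGroup (m : ℕ) : Type := PresentedGroup (braidRels m)

namespace BraidGroup

/-- The standard generators of the braid group. -/
def sigma {m : ℕ} (i : Fin (m - 1)) : BraidGroup m := PresentedGroup.of i

theorem sigma_comm {m : ℕ} {i j : Fin (m - 1)} (h : (i : ℕ) + 1 < j) :
    sigma i * sigma j = sigma j * sigma i := by
  have : PresentedGroup.mk (braidRels m)
      (FreeGroup.of i * FreeGroup.of j * (FreeGroup.of j * FreeGroup.of i)⁻¹) = 1 :=
    PresentedGroup.one_of_mem (Or.inl ⟨i, j, h, rfl⟩)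
  rw [map_mul, map_inv, mul_inv_eq_one] at this
  simpa only [map_mul, sigma, PresentedGroup.of] using this

theorem sigma_braid {m : ℕ} {i j : Fin (m - 1)} (h : (i : ℕ) + 1 = j) :
    sigma i * sigma j * sigma i = sigma j * sigma i * sigma j := by
  have : PresentedGroup.mk (braidRels m)
      (FreeGroup.of i * FreeGroup.of j * FreeGroup.of i *
        (FreeGroup.of j * FreeGroup.of i * FreeGroup.of j)⁻¹) = 1 :=
    PresentedGroup.one_of_mem (Or.inr ⟨i, j, h, rfl⟩)
  rw [map_mul, map_inv, mul_inv_eq_one] at this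
  simpa only [map_mul, sigma, PresentedGroup.of] using this

/-- The left one of the two positions that the `i`-th generator interchanges. -/
def lo {m : ℕ} (i : Fin (m - 1)) : Fin m := ⟨i, by have := i.isLt; omega⟩

/-- The right one of the two positions that the `i`-th generator interchanges. -/
def hi {m : ℕ} (i : Fin (m - 1)) : Fin m := ⟨i + 1, by have := i.isLt; omega⟩

/-- The underlying permutation of a braid. Braid words are read from left to right, so the
strand that starts in position `a` ends in position `(strandPerm β)⁻¹ a`. -/
def strandPerm (m : ℕ) : BraidGroup m →* Equiv.Perm (Fin m) :=
  PresentedGroup.toGroup (f := fun i => Equiv.swap (lo i) (hi i)) (by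
    rintro r (⟨i, j, h, rfl⟩ | ⟨i, j, h, rfl⟩) <;>
    · simp only [map_mul, map_inv, FreeGroup.lift_apply_of, mul_inv_eq_one]
      ext x
      simp only [Equiv.Perm.mul_apply, Equiv.swap_apply_def, lo, hi, Fin.ext_iff]
      grind)

/-- The embedding of the braid group on `k` strands into the braid group on `m` strands that
lets a braid act on the `k` consecutive strands in the positions `p, …, p + k - 1`. -/
def embed (k m p : ℕ) (h : p + k ≤ m) : BraidGroup k →* BraidGroup m :=
  PresentedGroup.toGroup
    (f := fun i : Fin (k - 1) => sigma ⟨p + i, by have := i.isLt; omega⟩) (by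
      rintro r (⟨i, j, hij, rfl⟩ | ⟨i, j, hij, rfl⟩)
      · simp only [map_mul, map_inv, FreeGroup.lift_apply_of, mul_inv_eq_one]
        exact sigma_comm (by simp only; omega)
      · simp only [map_mul, map_inv, FreeGroup.lift_apply_of, mul_inv_eq_one]
        exact sigma_braid (by simp only; omega))

end BraidGroup

/-! ### Braid words, deletion of strands, linking numbers of the closure -/

/-- A braid word: `(i, true)` stands for a generator and `(i, false)` for its inverse. -/
abbrev BraidWord (m : ℕ) : Type := List (Fin (m - 1) × Bool)

namespace BraidWord

open BraidGroup

/-- The braid that a word represents. -/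
def toBraid {m : ℕ} (w : BraidWord m) : BraidGroup m :=
  PresentedGroup.mk (braidRels m) (FreeGroup.mk w)

/-- The effect of one letter on positions. -/
def step {m : ℕ} (i : Fin (m - 1)) : Equiv.Perm (Fin m) := Equiv.swap (lo i) (hi i)

theorem rank_lt {m k : ℕ} {S : Finset (Fin m)} (hS : S.card = k) {i : Fin (m - 1)}
    (h : lo i ∈ S ∧ hi i ∈ S) : (S.filter (· < lo i)).card < k - 1 := by
  have h1 : insert (lo i) (insert (hi i) (S.filter (· < lo i))) ⊆ S := by
    intro x hx
    simp only [Finset.mem_insert, Finset.mem_filter] at hx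
    rcases hx with rfl | rfl | hx
    exacts [h.1, h.2, hx.1]
  have h2 := Finset.card_le_card h1
  have h3 : hi i ∉ S.filter (· < lo i) := by simp [lo, hi, Fin.lt_def]
  have h4 : lo i ∉ insert (hi i) (S.filter (· < lo i)) := by
    rw [Finset.mem_insert, Finset.mem_filter]
    simp [lo, hi]
  rw [Finset.card_insert_of_notMem h4, Finset.card_insert_of_notMem h3] at h2
  omega

/-- The word that remains when only the strands that start in the positions of `S` are kept and
all other strands are deleted; the `k` strands that are kept are renumbered in their order. -/
def restrict {m k : ℕ} : BraidWord m → (S : Finset (Fin m)) → S.card = k → BraidWord k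
  | [], _, _ => []
  | (i, b) :: w, S, hS =>
    let rest := restrict w (S.map (step i).toEmbedding) (by rw [Finset.card_map, hS])
    if h : lo i ∈ S ∧ hi i ∈ S then
      (⟨(S.filter (· < lo i)).card, rank_lt hS h⟩, b) :: rest
    else rest

/-- The signed number of crossings between the strands that start in the positions `x` and `y`;
a generator counts `1` and its inverse counts `-1`. -/
def crossings {m : ℕ} : BraidWord m → Fin m → Fin m → ℤ
  | [], _, _ => 0
  | (i, b) :: w, x, y =>
    (if (x = lo i ∧ y = hi i) ∨ (x = hi i ∧ y = lo i) then (if b then 1 else -1) else 0) +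
      crossings w (step i x) (step i y)

open Classical in
/-- The linking number of the components of the closed braid that contain the strands `x` and `y`:
half of the signed number of crossings between the two components. The components of the closure
are the cycles of the underlying permutation. -/
noncomputable def linkingNumber {m : ℕ} (w : BraidWord m) (x y : Fin m) : ℚ :=
  ((∑ a with (strandPerm m w.toBraid).SameCycle x a,
    ∑ b with (strandPerm m w.toBraid).SameCycle y b, w.crossings a b : ℤ) : ℚ) / 2

end BraidWord

/-! ### Oriented link diagrams and isotopy of links

A link diagram in general position with respect to a height function is cut into horizontal
slices, each of which holds one local minimum, one local maximum or one crossing. -/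

/-- An elementary slice; `i` is the number of strands to its left.
`cup i d` is a minimum, whose left leg is directed upwards if and only if `d = true`;
`cap i` is a maximum; `cross i b` is a crossing of two neighbouring strands, where
`b = true` means that the strand that moves from the left to the right is the upper one. -/
inductive Slice : Type
  | cup (i : ℕ) (d : Bool)
  | cap (i : ℕ)
  | cross (i : ℕ) (b : Bool)

namespace Slice

/-- The number of strands that enter a slice from below at its place. -/
def ins : Slice → ℕ
  | cup _ _ => 0
  | cap _ => 2
  | cross _ _ => 2

/-- The number of strands that leave a slice upwards at its place. -/
def outs : Slice → ℕ
  | cup _ _ => 2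
  | cap _ => 0
  | cross _ _ => 2

/-- The place of a slice. -/
def place : Slice → ℕ
  | cup i _ => i
  | cap i => i
  | cross i _ => i

/-- The same slice at another place. -/
def moveTo (j : ℕ) : Slice → Slice
  | cup _ d => cup j d
  | cap _ => cap j
  | cross _ b => cross j b

/-- The list of the directions of all strands above a slice in terms of that below it; undefined
if the slice does not fit there. -/
def run : Slice → List Bool → Option (List Bool)
  | cup i d, l => if i ≤ l.length then some (l.take i ++ d :: (!d) :: l.drop i) else none
  | cap i, l =>
    match l.drop i with
    | x :: y :: t => if x = !y then some (l.take i ++ t) else none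
    | _ => none
  | cross i _, l =>
    match l.drop i with
    | x :: y :: t => some (l.take i ++ y :: x :: t)
    | _ => none

end Slice

/-- A diagram: its slices from the bottom to the top. -/
abbrev SlicedDiagram : Type := List Slice

namespace SlicedDiagram

/-- The slices fit together to a closed oriented link diagram. -/
def IsLink (D : SlicedDiagram) : Prop :=
  D.foldlM (fun l (s : Slice) => s.run l) ([] : List Bool) = some []

/-- The local moves: planar isotopies and the Reidemeister moves. -/
inductive Move : SlicedDiagram → SlicedDiagram → Prop
  /-- two slices that involve disjoint sets of strands change their heights -/
  | far (s t : Slice) (h : s.place + s.outs ≤ t.place) :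
      Move [s, t] [t.moveTo (t.place + s.ins - s.outs), s]
  /-- a minimum and a maximum cancel -/
  | zigzag_left (i : ℕ) (d : Bool) : Move [.cup (i + 1) d, .cap i] []
  | zigzag_right (i : ℕ) (d : Bool) : Move [.cup i d, .cap (i + 1)] []
  /-- a minimum or a maximum is moved across a strand -/
  | slide_cup (i : ℕ) (d b : Bool) :
      Move [.cup i d, .cross (i + 1) b] [.cup (i + 1) d, .cross i (!b)]
  | slide_cap (i : ℕ) (b : Bool) :
      Move [.cross i b, .cap (i + 1)] [.cross (i + 1) (!b), .cap i]
  /-- the first Reidemeister move -/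
  | R1_cup (i : ℕ) (d b : Bool) : Move [.cup i d, .cross i b] [.cup i (!d)]
  | R1_cap (i : ℕ) (b : Bool) : Move [.cross i b, .cap i] [.cap i]
  /-- the second Reidemeister move -/
  | R2 (i : ℕ) (b : Bool) : Move [.cross i b, .cross i (!b)] []
  /-- the third Reidemeister move -/
  | R3 (i : ℕ) (b : Bool) :
      Move [.cross i b, .cross (i + 1) b, .cross i b]
        [.cross (i + 1) b, .cross i b, .cross (i + 1) b]

/-- Two diagrams represent isotopic oriented links: they are connected by a finite sequence of
local moves, performed within closed link diagrams, and their inverses. -/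
def Isotopic : SlicedDiagram → SlicedDiagram → Prop :=
  Relation.EqvGen fun D E => ∃ A B l r : SlicedDiagram, Move l r ∧
    D = A ++ l ++ B ∧ E = A ++ r ++ B ∧ D.IsLink ∧ E.IsLink

/-- `n` circles without crossings that lie beside each other. -/
def circles (n : ℕ) : SlicedDiagram := (List.replicate n [Slice.cup 0 true, Slice.cap 0]).flatten

end SlicedDiagram

/-- The diagram of the closure of a braid word: `m` nested minima, the braid on the `m` strands
on the left, all of them directed upwards, and `m` nested maxima. -/
def BraidWord.closure {m : ℕ} (w : BraidWord m) : SlicedDiagram :=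
  (List.range m).map (fun i => Slice.cup i true) ++
    w.map (fun x => Slice.cross x.1 x.2) ++
    (List.range m).reverse.map Slice.cap

/-! ### The braid monodromy process -/

/-- The local datum of a singularity (of a regeneration of it): the number of strands that
meet there, and the factors of the local braid on these strands. A branch point, node, cusp or
tangency has two strands and the single factor `σ ^ ε` with `ε = 1, 2, 3, 4`. -/
structure Singularity where
  strands : ℕ
  factors : List (BraidGroup strands)

/-- The local braid of a singularity. -/
def Singularity.braid (X : Singularity) : BraidGroup X.strands := X.factors.prod

/-- A singularity `X` as it is met in the process for a curve of degree `m`: in the fibre close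
to it, its strands are the consecutive ones in the positions `pos, …, pos + X.strands - 1`, and
`transport` is the braid that identifies the fibres on the two sides of the singularity (the
fibre beyond it is reached from the fibre before it by the inverse of `transport`). -/
structure Stage (m : ℕ) (X : Singularity) where
  pos : ℕ
  fits : pos + X.strands ≤ m
  transport : BraidGroup m

/-- The singularities of a curve of degree `m` in the order in which they are considered. -/
abbrev MonodromyProcess (m : ℕ) : Type := List (Σ X : Singularity, Stage m X)

namespace MonodromyProcess

open BraidGroup

variable {m : ℕ} {X : Singularity}

/-- The braid `δ_{j-1} ⋯ δ_0` with which the local braid of the `j`-th singularity has to be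
conjugated, where `δ_0, …, δ_{j-1}` are the transports at the preceding singularities. -/
def conjugator (P : MonodromyProcess m) (j : ℕ) : BraidGroup m :=
  ((P.take j).map fun e => e.2.transport).reverse.prod

/-- The factors that the singularity, met as the `j`-th one, contributes to the factorization:
each local factor, put on the strands of the fibre close to the singularity, and conjugated. -/
def resultingFactors (P : MonodromyProcess m) (j : ℕ) (s : Stage m X) : List (BraidGroup m) :=
  X.factors.map fun β =>
    (P.conjugator j)⁻¹ * embed X.strands m s.pos s.fits β * P.conjugator j

/-- The resulting braid of the singularity. -/
def contribution (P : MonodromyProcess m) (j : ℕ) (s : Stage m X) : BraidGroup m :=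
  (P.resultingFactors j s).prod

end MonodromyProcess

open BraidGroup in
/-- The position, in the fibre close to the singularity, of each of its local strands. -/
def Stage.localPosition {m : ℕ} {X : Singularity} (s : Stage m X) : Fin X.strands ↪ Fin m where
  toFun q := ⟨s.pos + q, by have := q.isLt; have := s.fits; omega⟩
  inj' a b h := by simpa [Fin.ext_iff] using h

open BraidGroup in
/-- The global index (the position in the base fibre) of each strand of the singularity: the
strands in the base fibre that are carried to the local ones by the inverse of the conjugator. -/
def MonodromyProcess.globalIndex {m : ℕ} {X : Singularity} (P : MonodromyProcess m) (j : ℕ)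
    (s : Stage m X) : Fin X.strands ↪ Fin m :=
  s.localPosition.trans ((strandPerm m (P.conjugator j))⁻¹).toEmbedding

/-- The local positions of the strands of the singularity, as a set. -/
def Stage.localStrands {m : ℕ} {X : Singularity} (s : Stage m X) : Finset (Fin m) :=
  Finset.univ.map s.localPosition

/-- The global indices of the strands of the singularity, as a set. -/
def MonodromyProcess.globalStrands {m : ℕ} {X : Singularity} (P : MonodromyProcess m) (j : ℕ)
    (s : Stage m X) : Finset (Fin m) :=
  Finset.univ.map (P.globalIndex j s)

theorem Stage.card_localStrands {m : ℕ} {X : Singularity} (s : Stage m X) :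
    s.localStrands.card = X.strands := by
  simp [Stage.localStrands]

theorem MonodromyProcess.card_globalStrands {m : ℕ} {X : Singularity} (P : MonodromyProcess m)
    (j : ℕ) (s : Stage m X) : (P.globalStrands j s).card = X.strands := by
  simp [MonodromyProcess.globalStrands]

theorem MonodromyProcess.card_compl_globalStrands {m : ℕ} {X : Singularity}
    (P : MonodromyProcess m) (j : ℕ) (s : Stage m X) :
    (P.globalStrands j s)ᶜ.card = m - X.strands := by
  simp [Finset.card_compl, MonodromyProcess.card_globalStrands]

/-! ### Braid words and braids -/

namespace BraidWord

open BraidGroup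

variable {m k : ℕ}

/-! The product of the conjugated factors is the single conjugate $\alpha^{-1}\iota_p(\beta)\alpha$,
because $\iota_p$ and conjugation are homomorphisms. Everything else is the behaviour of
$\iota_p(\beta)$, transported along this conjugation.

Crossing numbers, deletion of strands and closures are defined on words. `rel_of_toBraid_eq` reduces
their dependence on the braid alone to cancellation and the two defining relations. On
$\iota_p(\beta)$ all assertions are visible: no crossing involves a strand outside the block, and
renumbering the block gives back $\beta$. Conjugation by a word $u$ for $\alpha$ renames the strands
by `u.move`. In a restriction it adds the restriction of $u$ and its inverse
(`toBraid_restrict_conj`), which cancel when $k=2$ since $B_2$ is cyclic. In a linking number the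
crossings of $u$ and $u^{-1}$ cancel after summation over whole cycles (`linkingNumber_conj`).

Different positions are compared through position $0$: $\sigma_p\cdots\sigma_{p+k-1}$ carries one
strand across the block and so shifts $\iota_p$ to $\iota_{p+1}$ (`embed_succ_conj`). Hence $c$ and
$c'$ are conjugate.

Conjugate braids have isotopic closures because a letter can travel around the closure
(`closure_cons`). Thus $\iota_p(\beta)$ may be replaced by $\iota_0(\beta)$, whose crossings are
literally those of $\beta$. Each strand that is not braided is an innermost arc; it closes to a
circle that can be moved away (`cups_crosses_caps`). -/

@[simp] theorem toBraid_nil : BraidWord.toBraid ([] : BraidWord m) = 1 := rfl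

@[simp] theorem toBraid_append (w v : BraidWord m) :
    BraidWord.toBraid (w ++ v) = w.toBraid * v.toBraid := by
  simp only [toBraid, ← FreeGroup.mul_mk, map_mul]

theorem toBraid_cons (x : Fin (m - 1) × Bool) (w : BraidWord m) :
    BraidWord.toBraid (x :: w) = BraidWord.toBraid [x] * w.toBraid :=
  toBraid_append [x] w

@[simp] theorem toBraid_letter_true (i : Fin (m - 1)) :
    BraidWord.toBraid [(i, true)] = sigma i := rfl

@[simp] theorem toBraid_letter_false (i : Fin (m - 1)) :
    BraidWord.toBraid [(i, false)] = (sigma i)⁻¹ := rfl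

theorem exists_toBraid_eq (β : BraidGroup m) : ∃ w : BraidWord m, w.toBraid = β := by
  obtain ⟨g, rfl⟩ := QuotientGroup.mk_surjective β
  exact ⟨g.toWord, by rw [toBraid, FreeGroup.mk_toWord]; rfl⟩

/-- An equivalence relation on braid words that is compatible with adding a letter in front and
holds for the defining relations of the braid group contains the equality of braids. -/
theorem rel_of_toBraid_eq {r : BraidWord m → BraidWord m → Prop} (hr : Equivalence r)
    (hcons : ∀ x w v, r w v → r (x :: w) (x :: v))
    (hcancel : ∀ i b w, r ((i, b) :: (i, !b) :: w) w)
    (hcomm : ∀ i j : Fin (m - 1), (i : ℕ) + 1 < j → ∀ w,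
      r ((i, true) :: (j, true) :: w) ((j, true) :: (i, true) :: w))
    (hbraid : ∀ i j : Fin (m - 1), (i : ℕ) + 1 = j → ∀ w,
      r ((i, true) :: (j, true) :: (i, true) :: w) ((j, true) :: (i, true) :: (j, true) :: w))
    {w v : BraidWord m} (h : w.toBraid = v.toBraid) : r w v := by
  -- The braid group acts on the classes of words by adding letters in front: cancellation makes
  -- each letter invertible, and the other hypotheses give the defining relations. A word applied to
  -- the class of the empty word returns its own class, so equal braids have equal classes.
  let S : Setoid (BraidWord m) := ⟨r, hr⟩
  let pre (x : Fin (m - 1) × Bool) : Quotient S → Quotient S :=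
    Quotient.map (x :: ·) (hcons x)
  let f (i : Fin (m - 1)) : Equiv.Perm (Quotient S) :=
    { toFun := pre (i, true)
      invFun := pre (i, false)
      left_inv := by
        rintro ⟨w⟩
        exact Quotient.sound (hcancel i false w)
      right_inv := by
        rintro ⟨w⟩
        exact Quotient.sound (hcancel i true w) }
  let φ : BraidGroup m →* Equiv.Perm (Quotient S) := PresentedGroup.toGroup (f := f) (by
    rintro _ (⟨i, j, hij, rfl⟩ | ⟨i, j, hij, rfl⟩) <;>
      simp only [map_mul, map_inv, FreeGroup.lift_apply_of, mul_inv_eq_one] <;>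
      ext ⟨w⟩
    · exact Quotient.sound (hcomm i j hij w)
    · exact Quotient.sound (hbraid i j hij w))
  have hsigma (i : Fin (m - 1)) : φ (sigma i) = f i := PresentedGroup.toGroup.of _
  have key : ∀ u : BraidWord m, φ u.toBraid (Quotient.mk S []) = Quotient.mk S u := by
    intro u
    induction u with
    | nil => rw [toBraid_nil, map_one, Equiv.Perm.one_apply]
    | cons x u ih =>
      rw [toBraid_cons, map_mul, Equiv.Perm.mul_apply, ih]
      obtain ⟨i, b⟩ := x
      cases b
      · rw [toBraid_letter_false, map_inv, hsigma]; rfl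
      · rw [toBraid_letter_true, hsigma]; rfl
  exact Quotient.exact ((key w).symm.trans ((congrArg (φ · _) h).trans (key v)))

/-- The position in which the strand that starts in the position `x` ends. -/
def move : BraidWord m → Equiv.Perm (Fin m)
  | [] => 1
  | (i, _) :: w => move w * step i

/-- The inverse appears because words are read from the left, whereas a product of permutations
applies its right factor first. -/
theorem move_eq (w : BraidWord m) : w.move = (strandPerm m w.toBraid)⁻¹ := by
  have hs (i : Fin (m - 1)) : strandPerm m (sigma i) = step i := PresentedGroup.toGroup.of _
  induction w with
  | nil => rw [toBraid_nil, map_one, inv_one, move]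
  | cons x w ih =>
    obtain ⟨i, b⟩ := x
    rw [move, ih, toBraid_cons, map_mul, mul_inv_rev]
    congr 1
    cases b <;> simp [hs, step]

/-! ### Crossing numbers are invariants of braids -/

theorem crossings_append (w v : BraidWord m) (x y : Fin m) :
    crossings (w ++ v) x y = crossings w x y + crossings v (w.move x) (w.move y) := by
  induction w generalizing x y with
  | nil => simp [crossings, move]
  | cons l w ih =>
    obtain ⟨i, b⟩ := l
    simp [crossings, move, ih, add_assoc]

theorem step_apply (i : Fin (m - 1)) (x : Fin m) :
    step i x = if x = lo i then hi i else if x = hi i then lo i else x :=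
  Equiv.swap_apply_def _ _ _

@[simp] theorem step_lo (i : Fin (m - 1)) : step i (lo i) = hi i := Equiv.swap_apply_left _ _

@[simp] theorem step_hi (i : Fin (m - 1)) : step i (hi i) = lo i := Equiv.swap_apply_right _ _

theorem step_of_ne {i : Fin (m - 1)} {x : Fin m} (h : x ≠ lo i) (h' : x ≠ hi i) :
    step i x = x := Equiv.swap_apply_of_ne_of_ne h h'

@[simp] theorem step_step (i : Fin (m - 1)) (x : Fin m) : step i (step i x) = x :=
  Equiv.swap_apply_self _ _ _

theorem step_eq_iff {i : Fin (m - 1)} {x y : Fin m} : step i x = y ↔ x = step i y := by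
  rw [← (step i).injective.eq_iff, step_step]

theorem lo_ne_hi (i : Fin (m - 1)) : lo i ≠ hi i := by simp [lo, hi]

theorem step_comm {i j : Fin (m - 1)} (hij : (i : ℕ) + 1 < j) (z : Fin m) :
    step i (step j z) = step j (step i z) := by
  simp only [step_apply, lo, hi, Fin.ext_iff, apply_ite Fin.val]
  grind

theorem step_braid {i j : Fin (m - 1)} (hij : (i : ℕ) + 1 = j) (z : Fin m) :
    step i (step j (step i z)) = step j (step i (step j z)) := by
  simp only [step_apply, lo, hi, Fin.ext_iff, apply_ite Fin.val]
  grind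

theorem step_lo_of_far {i j : Fin (m - 1)} (h : (i : ℕ) + 1 < j ∨ (j : ℕ) + 1 < i) :
    step i (lo j) = lo j :=
  step_of_ne (by simp only [lo, ne_eq, Fin.ext_iff]; omega)
    (by simp only [lo, hi, ne_eq, Fin.ext_iff]; omega)

theorem step_hi_of_far {i j : Fin (m - 1)} (h : (i : ℕ) + 1 < j ∨ (j : ℕ) + 1 < i) :
    step i (hi j) = hi j :=
  step_of_ne (by simp only [lo, hi, ne_eq, Fin.ext_iff]; omega)
    (by simp only [hi, ne_eq, Fin.ext_iff]; omega)

theorem lo_eq_hi {i j : Fin (m - 1)} (h : (i : ℕ) + 1 = j) : lo j = hi i :=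
  Fin.ext h.symm

theorem step_hi_of_adjacent {i j : Fin (m - 1)} (h : (i : ℕ) + 1 = j) :
    step i (hi j) = hi j :=
  step_of_ne (by simp only [lo, hi, ne_eq, Fin.ext_iff]; omega)
    (by simp only [hi, ne_eq, Fin.ext_iff]; omega)

theorem step_lo_of_adjacent {i j : Fin (m - 1)} (h : (i : ℕ) + 1 = j) :
    step j (lo i) = lo i :=
  step_of_ne (by simp only [lo, ne_eq, Fin.ext_iff]; omega)
    (by simp only [lo, hi, ne_eq, Fin.ext_iff]; omega)

/-- Two inverse letters cross the same pair with opposite signs. The two sides of a defining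
relation cross the same pairs of strands with the same signs, in another order. `step_eq_iff`
expresses every condition by the starting positions, so that the terms can be matched. -/
theorem crossings_congr {w v : BraidWord m} (h : w.toBraid = v.toBraid) (x y : Fin m) :
    crossings w x y = crossings v x y := by
  refine rel_of_toBraid_eq (r := fun w v => ∀ x y, crossings w x y = crossings v x y)
    ⟨fun _ _ _ => rfl, fun h x y => (h x y).symm, fun h h' x y => (h x y).trans (h' x y)⟩
    ?_ ?_ ?_ ?_ h x y
  · rintro ⟨i, b⟩ w v h x y
    rw [crossings, crossings, h]
  · intro i b w x y
    simp only [crossings, step_step, step_eq_iff, step_lo, step_hi]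
    cases b <;> grind
  · intro i j hij w x y
    simp only [crossings, step_comm hij]
    simp only [step_eq_iff, step_lo_of_far (Or.inl hij), step_lo_of_far (Or.inr hij),
      step_hi_of_far (Or.inl hij), step_hi_of_far (Or.inr hij)]
    ring
  · intro i j hij w x y
    simp only [crossings, step_braid hij]
    simp only [step_eq_iff, lo_eq_hi hij, step_hi_of_adjacent hij, step_lo_of_adjacent hij,
      step_lo, step_hi, (lo_eq_hi hij) ▸ step_lo j, (lo_eq_hi hij) ▸ step_hi j]
    simp only [or_comm]
    ring

end BraidWord

/-! ### Generators indexed by natural numbers -/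

namespace BraidGroup

/-- The generator with index `n`; it is `1` if there is no such generator. -/
def gen (k n : ℕ) : BraidGroup k := if h : n < k - 1 then sigma ⟨n, h⟩ else 1

theorem gen_of_lt {k n : ℕ} (h : n < k - 1) : gen k n = sigma ⟨n, h⟩ := dif_pos h

theorem gen_comm (k : ℕ) {n l : ℕ} (h : n + 1 < l) : gen k n * gen k l = gen k l * gen k n := by
  by_cases hl : l < k - 1
  · rw [gen_of_lt hl, gen_of_lt (by omega : n < k - 1), sigma_comm h]
  · simp [gen, hl]

theorem gen_braid {k n : ℕ} (h : n + 1 < k - 1) :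
    gen k n * gen k (n + 1) * gen k n = gen k (n + 1) * gen k n * gen k (n + 1) := by
  rw [gen_of_lt h, gen_of_lt (by omega : n < k - 1), sigma_braid rfl]

end BraidGroup

namespace BraidWord

open BraidGroup

variable {m k : ℕ}

/-! ### Deletion of strands is an operation on braids -/

theorem mem_map_step {i : Fin (m - 1)} {S : Finset (Fin m)} {x : Fin m} :
    x ∈ S.map (step i).toEmbedding ↔ step i x ∈ S := by
  simp [step]

/-- The number of elements of `S` to the left of `x`. -/
def rank (S : Finset (Fin m)) (x : Fin m) : ℕ := (S.filter (· < x)).card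

/-- Only the cut between `lo i` and `hi i` separates the two positions that are exchanged, and this
cut is the one to the left of `hi i`. -/
theorem rank_map_step {i : Fin (m - 1)} {S : Finset (Fin m)} {x : Fin m} (hx : x ≠ hi i) :
    rank (S.map (step i).toEmbedding) x = rank S x := by
  rw [rank, Finset.filter_map, Finset.card_map, rank]
  congr 1
  refine Finset.filter_congr fun y _ => ?_
  simp only [Function.comp, Equiv.coe_toEmbedding, step_apply, lo, hi, Fin.lt_def, Fin.ext_iff,
    ne_eq] at *
  split_ifs <;> simp only <;> omega

theorem rank_hi (i : Fin (m - 1)) (S : Finset (Fin m)) :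
    rank S (hi i) = rank S (lo i) + if lo i ∈ S then 1 else 0 := by
  have : S.filter (· < hi i) = S.filter (· < lo i) ∪ S.filter (· = lo i) := by
    ext x
    simp only [Finset.mem_filter, Finset.mem_union, lo, hi, Fin.lt_def, Fin.ext_iff, ← and_or_left]
    refine and_congr_right fun _ => ?_
    omega
  rw [rank, this, Finset.card_union_of_disjoint, rank]
  · congr 1
    rw [Finset.filter_eq']
    split_ifs <;> rfl
  · rw [Finset.disjoint_filter]
    rintro x - h rfl
    exact lt_irrefl _ h

/-- Both strands of the left crossing are kept and lie to the left of `lo j`, so two far generators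
stay far apart after renumbering. -/
theorem rank_lo_mono {i j : Fin (m - 1)} (hij : (i : ℕ) + 1 < j) {S : Finset (Fin m)}
    (h : lo i ∈ S ∧ hi i ∈ S) : rank S (lo i) + 1 < rank S (lo j) := by
  have h1 : insert (lo i) (insert (hi i) (S.filter (· < lo i))) ⊆ S.filter (· < lo j) := by
    intro x hx
    simp only [Finset.mem_insert, Finset.mem_filter] at hx ⊢
    rcases hx with rfl | rfl | hx
    · exact ⟨h.1, by simp only [lo, Fin.lt_def]; omega⟩
    · exact ⟨h.2, by simp only [lo, hi, Fin.lt_def]; omega⟩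
    · refine ⟨hx.1, hx.2.trans ?_⟩
      simp only [lo, Fin.lt_def]; omega
  have h2 := Finset.card_le_card h1
  have h3 : hi i ∉ S.filter (· < lo i) := by simp [lo, hi, Fin.lt_def]
  have h4 : lo i ∉ insert (hi i) (S.filter (· < lo i)) := by
    rw [Finset.mem_insert, Finset.mem_filter]
    simp [lo, hi]
  rw [Finset.card_insert_of_notMem h4, Finset.card_insert_of_notMem h3] at h2
  simp only [rank]
  omega

theorem restrict_congr_set (w : BraidWord m) {S S' : Finset (Fin m)} (h : S = S')
    (hS : S.card = k) (hS' : S'.card = k) : w.restrict S hS = w.restrict S' hS' := by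
  subst h; rfl

/-- What remains of a generator when only the strands in the positions of `S` are kept. -/
def genRestrict (k : ℕ) (i : Fin (m - 1)) (S : Finset (Fin m)) : BraidGroup k :=
  if lo i ∈ S ∧ hi i ∈ S then gen k (rank S (lo i)) else 1

theorem toBraid_restrict_cons (i : Fin (m - 1)) (b : Bool) (w : BraidWord m)
    (S : Finset (Fin m)) (hS : S.card = k) :
    BraidWord.toBraid (restrict ((i, b) :: w) S hS) =
      (if b then genRestrict k i S else (genRestrict k i S)⁻¹) *
        (w.restrict (S.map (step i).toEmbedding) (by rw [Finset.card_map, hS])).toBraid := by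
  rw [restrict]
  by_cases h : lo i ∈ S ∧ hi i ∈ S
  · rw [dif_pos h, toBraid_cons]
    have : gen k (rank S (lo i)) = sigma ⟨_, rank_lt hS h⟩ := gen_of_lt _
    simp only [genRestrict, if_pos h, this]
    cases b <;> simp
  · simp [genRestrict, h]

theorem genRestrict_map_step (i : Fin (m - 1)) (S : Finset (Fin m)) :
    genRestrict k i (S.map (step i).toEmbedding) = genRestrict k i S := by
  simp only [genRestrict, mem_map_step, step_lo, step_hi, rank_map_step (lo_ne_hi i), and_comm]

theorem map_step_step (i : Fin (m - 1)) (S : Finset (Fin m)) :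
    (S.map (step i).toEmbedding).map (step i).toEmbedding = S := by
  ext x; simp only [mem_map_step, step_step]

theorem toBraid_restrict_congr {w v : BraidWord m} (h : w.toBraid = v.toBraid)
    (S : Finset (Fin m)) (hS : S.card = k) :
    (w.restrict S hS).toBraid = (v.restrict S hS).toBraid := by
  refine rel_of_toBraid_eq
    (r := fun w v => ∀ (S : Finset (Fin m)) (hS : S.card = k),
      (BraidWord.restrict w S hS).toBraid = (BraidWord.restrict v S hS).toBraid)
    ⟨fun _ _ _ => rfl, fun h x y => (h x y).symm, fun h h' x y => (h x y).trans (h' x y)⟩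
    ?_ ?_ ?_ ?_ h S hS
  · rintro ⟨i, b⟩ w v h S hS
    rw [toBraid_restrict_cons, toBraid_restrict_cons, h]
  · intro i b w S hS
    rw [toBraid_restrict_cons, toBraid_restrict_cons, genRestrict_map_step,
      restrict_congr_set w (map_step_step i S) _ hS]
    cases b <;> simp
  · intro i j hij w S hS
    simp only [toBraid_restrict_cons, if_true, ← mul_assoc]
    congr 1
    · have hi' : genRestrict k i (S.map (step j).toEmbedding) = genRestrict k i S := by
        simp only [genRestrict, mem_map_step, step_lo_of_far (Or.inr hij),
          step_hi_of_far (Or.inr hij)]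
        rw [rank_map_step (by simp only [lo, hi, ne_eq, Fin.ext_iff]; omega)]
      have hj' : genRestrict k j (S.map (step i).toEmbedding) = genRestrict k j S := by
        simp only [genRestrict, mem_map_step, step_lo_of_far (Or.inl hij),
          step_hi_of_far (Or.inl hij)]
        rw [rank_map_step (by simp only [lo, hi, ne_eq, Fin.ext_iff]; omega)]
      rw [hi', hj', genRestrict, genRestrict]
      split_ifs with h1 h2
      · exact gen_comm k (rank_lo_mono hij h1)
      all_goals simp
    · congr 1
      refine restrict_congr_set w ?_ _ _
      ext x
      simp only [mem_map_step, step_comm hij]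
  · intro i j hij w S hS
    simp only [toBraid_restrict_cons, if_true, ← mul_assoc]
    have hne : lo i ≠ hi j := by simp only [lo, hi, ne_eq, Fin.ext_iff]; omega
    have hij' : hi i = lo j := (lo_eq_hi hij).symm
    have e1 : step i (lo j) = lo i := by rw [← hij', step_hi]
    have e2 : step i (lo i) = lo j := by rw [← hij', step_lo]
    have hrank (S : Finset (Fin m)) : rank S (lo j) = rank S (lo i) + if lo i ∈ S then 1 else 0 :=
      hij' ▸ rank_hi i S
    congr 1
    · simp only [genRestrict, mem_map_step, hij', e1, e2, step_hi_of_adjacent hij,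
        step_lo_of_adjacent hij, step_lo, step_hi, hrank, rank_map_step (lo_ne_hi i),
        rank_map_step hne]
      -- The cases are the subsets of the three strands that are kept. With two strands kept, both
      -- sides are the same generator; with fewer they are trivial; with all three the braid
      -- relation itself is left.
      by_cases ha : lo i ∈ S <;> by_cases hb : lo j ∈ S <;> by_cases hc : hi j ∈ S <;>
        simp only [ha, hb, hc, and_self, and_true, and_false, if_true, if_false, mul_one, one_mul,
          add_zero]
      refine gen_braid ?_
      -- The right crossing has the renumbered index one higher than the left one, which gives the
      -- bound needed for the braid relation.
      have := rank_lt hS ⟨hb, hc⟩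
      have h2 := hrank S
      rw [if_pos ha] at h2
      rw [← h2]
      exact this
    · congr 1
      refine restrict_congr_set w ?_ _ _
      ext x
      simp only [mem_map_step, step_braid hij]

theorem restrict_append (w v : BraidWord m) (S : Finset (Fin m)) (hS : S.card = k) :
    restrict (w ++ v) S hS = w.restrict S hS ++
      v.restrict (S.map w.move.toEmbedding) (by rw [Finset.card_map, hS]) := by
  induction w generalizing S with
  | nil =>
    exact restrict_congr_set v Finset.map_refl.symm _ _
  | cons l w ih =>
    obtain ⟨i, b⟩ := l
    have e : (S.map (step i).toEmbedding).map (move w).toEmbedding =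
        S.map (move ((i, b) :: w)).toEmbedding := by
      rw [Finset.map_map]; rfl
    rw [List.cons_append, restrict, restrict, ih, restrict_congr_set v e]
    split_ifs <;> rfl

end BraidWord

/-! ### Deletion of strands in a conjugate -/

namespace BraidWord

open BraidGroup

variable {m k : ℕ}

theorem move_mul (w v : BraidWord m) : move (w ++ v) = v.move * w.move := by
  rw [move_eq, move_eq, move_eq, toBraid_append, map_mul, mul_inv_rev]

theorem move_eq_inv {u u' : BraidWord m} (hu : u'.toBraid = u.toBraid⁻¹) :
    u'.move = u.move⁻¹ := by
  rw [move_eq, move_eq, hu, map_inv]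

/-- The braid that remains of a conjugate, when only the strands are kept that the conjugating
braid carries to a set of strands which is preserved by the given braid. -/
theorem toBraid_restrict_conj {w z u : BraidWord m}
    (h : w.toBraid = u.toBraid⁻¹ * z.toBraid * u.toBraid) {L T : Finset (Fin m)}
    (hL : L.map z.move.toEmbedding = L) (hT : L.map u.move.toEmbedding = T)
    (hLk : L.card = k) (hTk : T.card = k) :
    (w.restrict T hTk).toBraid =
      (u.restrict L hLk).toBraid⁻¹ * (z.restrict L hLk).toBraid * (u.restrict L hLk).toBraid := by
  obtain ⟨u', hu'⟩ := exists_toBraid_eq u.toBraid⁻¹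
  have hTL : T.map u'.move.toEmbedding = L := by
    rw [← hT, move_eq_inv hu', Finset.map_map]
    convert Finset.map_refl (s := L)
    ext x; simp
  -- Restricting the trivial braid `u' ++ u` to `T` gives the restriction of `u'` to `T` followed by
  -- that of `u` to `L`, since `u'` carries `T` to `L`.
  have h1 : (u'.restrict T hTk).toBraid = (u.restrict L hLk).toBraid⁻¹ := by
    rw [eq_inv_iff_mul_eq_one, ← restrict_congr_set u hTL (by rw [Finset.card_map, hTk]) hLk,
      ← toBraid_append, ← restrict_append,
      toBraid_restrict_congr (v := []) (by rw [toBraid_append, hu', inv_mul_cancel, toBraid_nil])]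
    rfl
  rw [toBraid_restrict_congr (v := u' ++ (z ++ u)) (by
      rw [toBraid_append, toBraid_append, hu', h, mul_assoc]),
    restrict_append, restrict_congr_set (z ++ u) hTL _ hLk, restrict_append,
    restrict_congr_set u hL _ hLk, toBraid_append, toBraid_append, h1, mul_assoc]

/-! ### Braids on consecutive strands -/

/-- The positions of `k` consecutive strands. -/
def shiftPos {p : ℕ} (h : p + k ≤ m) : Fin k ↪ Fin m where
  toFun q := ⟨p + q, by omega⟩
  inj' a b h := by simpa [Fin.ext_iff] using h

/-- A braid word on `k` consecutive strands. -/
def shift {p : ℕ} (h : p + k ≤ m) (v : BraidWord k) : BraidWord m :=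
  v.map fun x => (⟨p + x.1, by omega⟩, x.2)

theorem toBraid_shift {p : ℕ} (h : p + k ≤ m) (v : BraidWord k) :
    (shift h v).toBraid = embed k m p h v.toBraid := by
  induction v with
  | nil => rw [toBraid_nil, map_one]; rfl
  | cons x v ih =>
    rw [toBraid_cons x, map_mul, ← ih]
    obtain ⟨i, b⟩ := x
    have hi : embed k m p h (sigma i) = sigma ⟨p + i, by omega⟩ := PresentedGroup.toGroup.of _
    change BraidWord.toBraid (_ :: shift h v) = _
    rw [toBraid_cons]
    congr 1
    cases b <;> simp [hi]

variable {p : ℕ} (h : p + k ≤ m)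

theorem lo_shift (i : Fin (k - 1)) :
    lo (⟨p + i, by omega⟩ : Fin (m - 1)) = shiftPos h (lo i) := rfl

theorem hi_shift (i : Fin (k - 1)) :
    hi (⟨p + i, by omega⟩ : Fin (m - 1)) = shiftPos h (hi i) := rfl

theorem step_shift (i : Fin (k - 1)) (q : Fin k) :
    step (⟨p + i, by omega⟩ : Fin (m - 1)) (shiftPos h q) = shiftPos h (step i q) := by
  simp only [step_apply, lo_shift h, hi_shift h, (shiftPos h).injective.eq_iff]
  split_ifs <;> rfl

theorem step_shift_of_notMem (i : Fin (k - 1)) {x : Fin m}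
    (hx : x ∉ Finset.univ.map (shiftPos h)) :
    step (⟨p + i, by omega⟩ : Fin (m - 1)) x = x := by
  refine step_of_ne ?_ ?_ <;> rintro rfl <;> refine hx (Finset.mem_map.2 ?_)
  exacts [⟨lo i, Finset.mem_univ _, rfl⟩, ⟨hi i, Finset.mem_univ _, rfl⟩]

theorem move_shift (v : BraidWord k) (q : Fin k) :
    (shift h v).move (shiftPos h q) = shiftPos h (v.move q) := by
  induction v generalizing q with
  | nil => rfl
  | cons x v ih =>
    change (shift h v).move (step _ _) = _
    rw [step_shift, ih]; rfl

theorem move_shift_of_notMem (v : BraidWord k) {x : Fin m}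
    (hx : x ∉ Finset.univ.map (shiftPos h)) : (shift h v).move x = x := by
  induction v with
  | nil => rfl
  | cons y v ih =>
    change (shift h v).move (step _ _) = _
    rw [step_shift_of_notMem h _ hx, ih]

theorem map_step_shift (i : Fin (k - 1)) :
    (Finset.univ.map (shiftPos h)).map
      (step (⟨p + i, by omega⟩ : Fin (m - 1))).toEmbedding = Finset.univ.map (shiftPos h) := by
  refine Finset.eq_of_subset_of_card_le (fun x hx => ?_) (by simp)
  simp only [Finset.mem_map, Finset.mem_univ, true_and] at hx
  obtain ⟨_, ⟨q, rfl⟩, rfl⟩ := hx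
  rw [Equiv.coe_toEmbedding, step_shift h]
  exact Finset.mem_map_of_mem _ (Finset.mem_univ _)

theorem map_move_shift (v : BraidWord k) :
    (Finset.univ.map (shiftPos h)).map (shift h v).move.toEmbedding =
      Finset.univ.map (shiftPos h) := by
  refine Finset.eq_of_subset_of_card_le (fun x hx => ?_) (by simp)
  simp only [Finset.mem_map, Finset.mem_univ, true_and] at hx
  obtain ⟨_, ⟨q, rfl⟩, rfl⟩ := hx
  rw [Equiv.coe_toEmbedding, move_shift h]
  exact Finset.mem_map_of_mem _ (Finset.mem_univ _)

theorem map_compl (e : Equiv.Perm (Fin m)) (S : Finset (Fin m)) :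
    Sᶜ.map e.toEmbedding = (S.map e.toEmbedding)ᶜ := by
  ext x; simp

theorem rank_shift (q : Fin k) : rank (Finset.univ.map (shiftPos h)) (shiftPos h q) = q := by
  have : (Finset.univ.filter ((· < shiftPos h q) ∘ shiftPos h)) = Finset.Iio q := by
    ext r
    simp only [Finset.mem_filter, Finset.mem_univ, true_and, Function.comp, Finset.mem_Iio]
    exact Nat.add_lt_add_iff_left
  rw [rank, Finset.filter_map, Finset.card_map, this, Fin.card_Iio]

theorem restrict_shift (v : BraidWord k) (hk : (Finset.univ.map (shiftPos h)).card = k) :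
    (shift h v).restrict (Finset.univ.map (shiftPos h)) hk = v := by
  induction v with
  | nil => rfl
  | cons x v ih =>
    obtain ⟨i, b⟩ := x
    change restrict (_ :: shift h v) _ _ = _
    have hmem (q : Fin k) : shiftPos h q ∈ Finset.univ.map (shiftPos h) :=
      Finset.mem_map_of_mem _ (Finset.mem_univ q)
    rw [restrict, dif_pos ⟨hmem (lo i), hmem (hi i)⟩, restrict_congr_set _ (map_step_shift h i) _ hk, ih]
    congr 2
    exact Fin.ext (rank_shift h (lo i))

theorem restrict_shift_compl {l : ℕ} (v : BraidWord k)
    (hl : (Finset.univ.map (shiftPos h))ᶜ.card = l) :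
    (shift h v).restrict (Finset.univ.map (shiftPos h))ᶜ hl = [] := by
  induction v with
  | nil => rfl
  | cons x v ih =>
    obtain ⟨i, b⟩ := x
    change restrict (_ :: shift h v) _ _ = _
    have e := map_compl (step (⟨p + i, by omega⟩ : Fin (m - 1))) (Finset.univ.map (shiftPos h))
    rw [map_step_shift h i] at e
    rw [restrict, dif_neg, restrict_congr_set _ e _ hl, ih]
    rintro ⟨h1, -⟩
    exact Finset.mem_compl.1 h1 (Finset.mem_map_of_mem _ (Finset.mem_univ (lo i)))

/-! ### Linking numbers -/

theorem linkingNumber_congr {w v : BraidWord m} (e : w.toBraid = v.toBraid) (x y : Fin m) :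
    w.linkingNumber x y = v.linkingNumber x y := by
  simp only [linkingNumber, e, crossings_congr e]

theorem sameCycle_iff_move (w : BraidWord m) (x y : Fin m) :
    (strandPerm m w.toBraid).SameCycle x y ↔ w.move.SameCycle x y := by
  rw [move_eq, Equiv.Perm.sameCycle_inv]

theorem crossings_inv {u u' : BraidWord m} (hu : u'.toBraid = u.toBraid⁻¹) (x y : Fin m) :
    crossings u' (u.move x) (u.move y) = - crossings u x y := by
  have := crossings_congr (w := u ++ u') (v := []) (by
    rw [toBraid_append, hu, mul_inv_cancel, toBraid_nil]) x y
  rw [crossings_append, crossings] at this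
  omega

open Classical in
theorem sum_sameCycle_move {M : Type*} [AddCommMonoid M] (e : Equiv.Perm (Fin m)) (x : Fin m)
    (f : Fin m → M) :
    ∑ a with e.SameCycle x a, f (e a) = ∑ a with e.SameCycle x a, f a := by
  refine Finset.sum_equiv e (fun a => ?_) fun _ _ => rfl
  simp

open Classical in
theorem linkingNumber_conj {w z u : BraidWord m}
    (e : w.toBraid = u.toBraid⁻¹ * z.toBraid * u.toBraid) (x y : Fin m) :
    w.linkingNumber (u.move x) (u.move y) = z.linkingNumber x y := by
  obtain ⟨u', hu'⟩ := exists_toBraid_eq u.toBraid⁻¹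
  have hw : w.toBraid = BraidWord.toBraid (u' ++ (z ++ u)) := by
    rw [toBraid_append, toBraid_append, hu', e, mul_assoc]
  rw [linkingNumber_congr hw]
  simp only [linkingNumber, sameCycle_iff_move]
  have hmove : move (u' ++ (z ++ u)) = u.move * z.move * u.move⁻¹ := by
    rw [move_mul, move_mul, move_eq_inv hu']
  have hcyc (x : Fin m) (f : Fin m → ℤ) :
      ∑ a with (move (u' ++ (z ++ u))).SameCycle (u.move x) a, f a =
        ∑ a with z.move.SameCycle x a, f (u.move a) := by
    refine (Finset.sum_equiv u.move (fun a => ?_) fun _ _ => rfl).symm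
    simp [hmove, Equiv.Perm.sameCycle_conj]
  have hcr (a b : Fin m) : crossings (u' ++ (z ++ u)) (u.move a) (u.move b) =
      - crossings u a b + (crossings z a b + crossings u (z.move a) (z.move b)) := by
    rw [crossings_append, crossings_append, crossings_inv hu', move_eq_inv hu',
      Equiv.Perm.inv_def, Equiv.symm_apply_apply, Equiv.symm_apply_apply]
  rw [hcyc]
  simp only [hcyc, hcr, Finset.sum_add_distrib, Finset.sum_neg_distrib]
  -- The crossings of `u` are counted at the positions after `z`, those of its inverse at the
  -- positions before. Summed over whole cycles of `z`, these are equal and cancel.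
  have : ∑ a with z.move.SameCycle x a, ∑ b with z.move.SameCycle y b,
        crossings u (z.move a) (z.move b) =
      ∑ a with z.move.SameCycle x a, ∑ b with z.move.SameCycle y b, crossings u a b := by
    rw [← sum_sameCycle_move z.move x
      fun a => ∑ b with z.move.SameCycle y b, crossings u a b]
    exact Finset.sum_congr rfl fun a _ => sum_sameCycle_move z.move y fun b => crossings u _ b
  rw [this]
  congr 2
  ring

theorem crossings_shift (v : BraidWord k) (q r : Fin k) :
    crossings (shift h v) (shiftPos h q) (shiftPos h r) = crossings v q r := by
  induction v generalizing q r with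
  | nil => rfl
  | cons x v ih =>
    obtain ⟨i, b⟩ := x
    change crossings (_ :: shift h v) _ _ = _
    simp only [crossings, step_shift h, ih, lo_shift h, hi_shift h,
      (shiftPos h).injective.eq_iff]

theorem crossings_shift_of_notMem (v : BraidWord k) {x : Fin m}
    (hx : x ∉ Finset.univ.map (shiftPos h)) (y : Fin m) : crossings (shift h v) x y = 0 := by
  induction v generalizing y with
  | nil => rfl
  | cons l v ih =>
    obtain ⟨i, b⟩ := l
    change crossings (_ :: shift h v) _ _ = _
    rw [crossings, step_shift_of_notMem h i hx, ih, if_neg, add_zero]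
    rintro (⟨rfl, -⟩ | ⟨rfl, -⟩) <;> refine hx (Finset.mem_map.2 ?_)
    exacts [⟨lo i, Finset.mem_univ _, rfl⟩, ⟨hi i, Finset.mem_univ _, rfl⟩]

theorem move_zpow_shift (v : BraidWord k) (n : ℤ) (q : Fin k) :
    ((shift h v).move ^ n) (shiftPos h q) = shiftPos h ((v.move ^ n) q) := by
  have hinv (q : Fin k) : (shift h v).move⁻¹ (shiftPos h q) = shiftPos h (v.move⁻¹ q) := by
    rw [Equiv.Perm.inv_eq_iff_eq, move_shift, Equiv.Perm.inv_def, Equiv.apply_symm_apply]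
  induction n generalizing q with
  | zero => rfl
  | succ n ih => rw [zpow_add_one, zpow_add_one, Equiv.Perm.mul_apply, move_shift, ih]; rfl
  | pred n ih => rw [zpow_sub_one, zpow_sub_one, Equiv.Perm.mul_apply, hinv, ih]; rfl

theorem sameCycle_shift (v : BraidWord k) (q r : Fin k) :
    (shift h v).move.SameCycle (shiftPos h q) (shiftPos h r) ↔ v.move.SameCycle q r := by
  simp only [Equiv.Perm.SameCycle, move_zpow_shift, (shiftPos h).injective.eq_iff]

open Classical in
theorem linkingNumber_shift (v : BraidWord k) (q r : Fin k) :
    (shift h v).linkingNumber (shiftPos h q) (shiftPos h r) = v.linkingNumber q r := by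
  have hcyc (q : Fin k) (f : Fin m → ℤ) :
      ∑ a with (shift h v).move.SameCycle (shiftPos h q) a, f a =
        ∑ a with v.move.SameCycle q a, f (shiftPos h a) := by
    rw [← Finset.sum_map _ (shiftPos h)]
    congr 1
    ext x
    simp only [Finset.mem_filter, Finset.mem_univ, true_and, Finset.mem_map]
    refine ⟨?_, ?_⟩
    · rintro ⟨n, rfl⟩
      exact ⟨_, ⟨n, rfl⟩, (move_zpow_shift h v n q).symm⟩
    · rintro ⟨a, ha, rfl⟩
      exact (sameCycle_shift h v q a).2 ha
  simp only [linkingNumber, sameCycle_iff_move, hcyc, crossings_shift]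

open Classical in
theorem linkingNumber_shift_of_notMem (v : BraidWord k) {x : Fin m}
    (hx : x ∉ Finset.univ.map (shiftPos h)) (y : Fin m) :
    (shift h v).linkingNumber x y = 0 := by
  have : ∑ a with (shift h v).move.SameCycle x a,
      ∑ b with (shift h v).move.SameCycle y b, (shift h v).crossings a b = 0 := by
    refine Finset.sum_eq_zero fun a ha => Finset.sum_eq_zero fun b _ => ?_
    have hfix : Function.IsFixedPt (shift h v).move x := move_shift_of_notMem h v hx
    rw [← (Finset.mem_filter.1 ha).2.eq_of_left hfix]
    exact crossings_shift_of_notMem h v hx b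
  simp only [linkingNumber, sameCycle_iff_move, this, Int.cast_zero, zero_div]

end BraidWord

namespace BraidGroup

open BraidWord

/-! ### Conjugacy of the embeddings -/

theorem gen_mul_prod_comm (m p n l : ℕ) (hl : p + n + 1 ≤ l) :
    gen m l * ((List.range n).map fun i => gen m (p + i)).prod =
      ((List.range n).map fun i => gen m (p + i)).prod * gen m l := by
  refine Commute.list_prod_right _ _ fun x hx => ?_
  obtain ⟨i, hi, rfl⟩ := List.mem_map.1 hx
  rw [List.mem_range] at hi
  exact (gen_comm m (by omega)).symm

/-- The far generators commute past, and one braid relation between the factors of index `p + i` and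
`p + i + 1` raises the index. The condition on `i` says that both factors occur in the product. -/
theorem prod_gen_mul (m p n i : ℕ) (hi : i + 1 < n) (hm : p + n ≤ m - 1) :
    ((List.range n).map fun i => gen m (p + i)).prod * gen m (p + i) =
      gen m (p + i + 1) * ((List.range n).map fun i => gen m (p + i)).prod := by
  induction n with
  | zero => omega
  | succ n ih =>
    rw [List.range_succ, List.map_append, List.prod_append, List.map_singleton,
      List.prod_singleton]
    rcases Nat.lt_or_ge (i + 1) n with h | h
    · rw [mul_assoc, ← gen_comm m (by omega : p + i + 1 < p + n), ← mul_assoc,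
        ih h (by omega), mul_assoc]
    · obtain rfl : n = i + 1 := by omega
      rw [List.range_succ, List.map_append, List.prod_append, List.map_singleton,
        List.prod_singleton]
      have h1 := gen_braid (k := m) (n := p + i) (by omega)
      have h2 := gen_mul_prod_comm m p i (p + i + 1) le_rfl
      rw [← add_assoc, mul_assoc, mul_assoc, ← mul_assoc (gen m (p + i)), h1, ← mul_assoc,
        ← mul_assoc, ← h2]
      simp only [mul_assoc]

/-- The conjugating braid takes one strand across the block of `k` strands. Conjugation is a
homomorphism, so it suffices to compare generators. -/
theorem embed_succ_conj {k m p : ℕ} (h : p + 1 + k ≤ m) :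
    ∃ τ : BraidGroup m, ∀ β, τ * embed k m p (by omega) β * τ⁻¹ = embed k m (p + 1) h β := by
  refine ⟨((List.range k).map fun i => gen m (p + i)).prod, fun β => ?_⟩
  have : (MulAut.conj ((List.range k).map fun i => gen m (p + i)).prod).toMonoidHom.comp
      (embed k m p (by omega)) = embed k m (p + 1) h := by
    refine PresentedGroup.ext fun i => ?_
    have hi := i.isLt
    have e1 : embed k m p (by omega) (PresentedGroup.of i) = gen m (p + i) :=
      (PresentedGroup.toGroup.of _).trans (gen_of_lt (by omega)).symm
    have e2 : embed k m (p + 1) h (PresentedGroup.of i) = gen m (p + i + 1) :=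
      (PresentedGroup.toGroup.of _).trans
        ((gen_of_lt (by omega : p + 1 + i < m - 1)).symm.trans (by rw [add_right_comm]))
    rw [e2, MonoidHom.comp_apply, e1]
    rw [MulEquiv.coe_toMonoidHom, MulAut.conj_apply, prod_gen_mul m p k i (by omega) (by omega), mul_inv_cancel_right]
  exact DFunLike.congr_fun this β

theorem isConj_embed_zero {k m : ℕ} (p : ℕ) (h : p + k ≤ m) (β : BraidGroup k) :
    IsConj (embed k m 0 (by omega) β) (embed k m p h β) := by
  induction p with
  | zero => exact IsConj.refl _
  | succ p ih =>
    obtain ⟨τ, hτ⟩ := embed_succ_conj h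
    exact (ih (by omega)).trans (isConj_iff.2 ⟨τ, hτ β⟩)

/-- The group on two strands is generated by one element. The number of strands is given by an
equation, as is the case for a singularity. -/
theorem mul_comm_of_eq_two {k : ℕ} (hk : k = 2) (α β : BraidGroup k) : α * β = β * α := by
  subst hk
  have key (γ : BraidGroup 2) : γ ∈ Subgroup.zpowers (sigma (0 : Fin 1) : BraidGroup 2) := by
    obtain ⟨w, rfl⟩ := exists_toBraid_eq γ
    induction w with
    | nil => exact one_mem _
    | cons x w ih =>
      rw [toBraid_cons]
      refine mul_mem ?_ ih
      obtain ⟨i, b⟩ := x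
      obtain rfl : i = (0 : Fin 1) := Subsingleton.elim (α := Fin 1) _ _
      cases b
      · exact inv_mem (Subgroup.mem_zpowers _)
      · exact Subgroup.mem_zpowers _
  obtain ⟨a, rfl⟩ := key α
  obtain ⟨b, rfl⟩ := key β
  exact ((Commute.refl _).zpow_zpow a b)

end BraidGroup

/-! ### Isotopy of tangle diagrams -/

namespace Slice

theorem moveTo_place (s : Slice) : s.moveTo s.place = s := by cases s <;> rfl

theorem moveTo_moveTo (s : Slice) (i j : ℕ) : (s.moveTo i).moveTo j = s.moveTo j := by
  cases s <;> rfl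

@[simp] theorem place_moveTo (s : Slice) (i : ℕ) : (s.moveTo i).place = i := by cases s <;> rfl

@[simp] theorem ins_moveTo (s : Slice) (i : ℕ) : (s.moveTo i).ins = s.ins := by cases s <;> rfl

@[simp] theorem outs_moveTo (s : Slice) (i : ℕ) : (s.moveTo i).outs = s.outs := by
  cases s <;> rfl

/-- The same slice with one more strand to its left. -/
def up (s : Slice) : Slice := s.moveTo (s.place + 1)

/-- The added leftmost strand is not touched. This permits induction on the place of a slice, with
only place `0` computed explicitly. -/
theorem run_up_cons (s : Slice) (x : Bool) (L : List Bool) :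
    s.up.run (x :: L) = (s.run L).map (x :: ·) := by
  cases s with
  | cup i d =>
    simp only [up, moveTo, place, run, List.length_cons, Nat.add_le_add_iff_right]
    split_ifs <;> simp
  | cap i =>
    simp only [up, moveTo, place, run, List.drop_succ_cons, List.take_succ_cons]
    rcases L.drop i with _ | ⟨y, _ | ⟨z, t⟩⟩
    · rfl
    · rfl
    · simp only
      split_ifs <;> rfl
  | cross i b =>
    simp only [up, moveTo, place, run, List.drop_succ_cons, List.take_succ_cons]
    rcases L.drop i with _ | ⟨y, _ | ⟨z, t⟩⟩ <;> rfl

theorem run_up_nil (s : Slice) : s.up.run [] = none := by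
  cases s <;> simp [up, moveTo, place, run]

theorem run_cup_zero (d : Bool) (L : List Bool) : (cup 0 d).run L = some (d :: (!d) :: L) := rfl

theorem run_cap_zero_nil : (cap 0).run [] = none := rfl

theorem run_cap_zero_singleton (x : Bool) : (cap 0).run [x] = none := rfl

theorem run_cap_zero (x y : Bool) (L : List Bool) :
    (cap 0).run (x :: y :: L) = if x = !y then some L else none := rfl

theorem run_cross_zero_nil (b : Bool) : (cross 0 b).run [] = none := rfl

theorem run_cross_zero_singleton (b x : Bool) : (cross 0 b).run [x] = none := rfl

theorem run_cross_zero (b x y : Bool) (L : List Bool) :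
    (cross 0 b).run (x :: y :: L) = some (y :: x :: L) := rfl

theorem length_run {s : Slice} {L L' : List Bool} (h : s.run L = some L') :
    L'.length + s.ins = L.length + s.outs := by
  cases s with
  | cup i d =>
    simp only [run] at h
    split_ifs at h with hi
    obtain rfl := Option.some.inj h
    simp [ins, outs]
    omega
  | cap i =>
    simp only [run] at h
    have hl := congrArg List.length (List.take_append_drop i L)
    rw [List.length_append] at hl
    rcases hd : L.drop i with _ | ⟨y, _ | ⟨z, t⟩⟩ <;> simp only [hd] at h hl <;> try cases h
    split_ifs at h
    obtain rfl := Option.some.inj h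
    rw [← hl]
    simp only [ins, outs, List.length_append, List.length_cons]
    omega
  | cross i b =>
    simp only [run] at h
    have hl := congrArg List.length (List.take_append_drop i L)
    rw [List.length_append] at hl
    rcases hd : L.drop i with _ | ⟨y, _ | ⟨z, t⟩⟩ <;> simp only [hd] at h hl <;> try cases h
    rw [← hl]
    simp only [ins, outs, List.length_append, List.length_cons]

end Slice

/-! ### Strand directions and isotopy of parts of closed diagrams -/

namespace SlicedDiagram

open Slice

/-- The directions of the strands above a diagram in terms of those below it. -/
def run (D : SlicedDiagram) (L : List Bool) : Option (List Bool) :=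
  D.foldlM (fun l (s : Slice) => s.run l) L

@[simp] theorem run_nil (L : List Bool) : run [] L = some L := rfl

theorem run_cons (s : Slice) (D : SlicedDiagram) (L : List Bool) :
    run (s :: D) L = (s.run L).bind (run D) := rfl

theorem run_append (D E : SlicedDiagram) (L : List Bool) :
    run (D ++ E) L = (run D L).bind (run E) := by
  rw [run, List.foldlM_append]; rfl

theorem isLink_iff {D : SlicedDiagram} : D.IsLink ↔ run D [] = some [] := Iff.rfl

theorem length_run {D : SlicedDiagram} {L L' : List Bool} (h : run D L = some L') :
    L'.length + (D.map ins).sum = L.length + (D.map outs).sum := by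
  induction D generalizing L with
  | nil => cases h; rfl
  | cons s D ih =>
    rw [run_cons] at h
    obtain ⟨M, hM, h⟩ := Option.bind_eq_some_iff.1 h
    have h1 := Slice.length_run hM
    have h2 := ih h
    simp only [List.map_cons, List.sum_cons]
    omega

theorem run_map_up_cons (D : SlicedDiagram) (x : Bool) (L : List Bool) :
    run (D.map up) (x :: L) = (run D L).map (x :: ·) := by
  induction D generalizing L with
  | nil => rfl
  | cons s D ih =>
    rw [List.map_cons, run_cons, run_cons, run_up_cons]
    cases s.run L with
    | none => rfl
    | some M => exact ih M

/-- Nonemptiness is needed below no strands: there a raised slice does not fit, while an empty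
diagram always does. -/
theorem run_map_up_congr {D E : SlicedDiagram} (hD : D ≠ []) (hE : E ≠ [])
    (h : ∀ L, run D L = run E L) (L : List Bool) : run (D.map up) L = run (E.map up) L := by
  cases L with
  | cons x L => rw [run_map_up_cons, run_map_up_cons, h]
  | nil =>
    obtain ⟨s, D, rfl⟩ := List.exists_cons_of_ne_nil hD
    obtain ⟨t, E, rfl⟩ := List.exists_cons_of_ne_nil hE
    rw [List.map_cons, List.map_cons, run_cons, run_cons, run_up_nil, run_up_nil]
    rfl

/-- Two tangle diagrams with at least `n` strands at the bottom are isotopic, whatever diagrams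
are put below and above them. -/
def LocallyIsotopic (n : ℕ) (D E : SlicedDiagram) : Prop :=
  ∀ L : List Bool, n ≤ L.length → run D L = run E L ∧
    ∀ A B : SlicedDiagram, run A [] = some L → IsLink (A ++ D ++ B) →
      Isotopic (A ++ D ++ B) (A ++ E ++ B)

namespace LocallyIsotopic

variable {n n' : ℕ} {D E F : SlicedDiagram}

theorem refl (n : ℕ) (D : SlicedDiagram) : LocallyIsotopic n D D :=
  fun _ _ => ⟨rfl, fun _ _ _ _ => Relation.EqvGen.refl _⟩

/-- Equal effect on directions keeps the whole diagram a closed oriented link, as is demanded of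
each step of an isotopy. -/
theorem isLink_congr {A B : SlicedDiagram} {L : List Bool} (hA : run A [] = some L)
    (h : run D L = run E L) : IsLink (A ++ D ++ B) ↔ IsLink (A ++ E ++ B) := by
  rw [isLink_iff, isLink_iff, run_append, run_append, run_append, run_append, hA,
    Option.bind_some, Option.bind_some, h]

theorem symm (h : LocallyIsotopic n D E) : LocallyIsotopic n E D := fun L hL =>
  ⟨(h L hL).1.symm, fun A B hA hE =>
    .symm _ _ ((h L hL).2 A B hA ((isLink_congr hA (h L hL).1).2 hE))⟩

theorem trans (h : LocallyIsotopic n D E) (h' : LocallyIsotopic n E F) :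
    LocallyIsotopic n D F := fun L hL =>
  ⟨(h L hL).1.trans (h' L hL).1, fun A B hA hD =>
    .trans _ _ _ ((h L hL).2 A B hA hD)
      ((h' L hL).2 A B hA ((isLink_congr hA (h L hL).1).1 hD))⟩

theorem mono (h : LocallyIsotopic n D E) (hn : n ≤ n') : LocallyIsotopic n' D E :=
  fun L hL => h L (hn.trans hL)

theorem append_right (h : LocallyIsotopic n D E) (F : SlicedDiagram) :
    LocallyIsotopic n (D ++ F) (E ++ F) := fun L hL =>
  ⟨by rw [run_append, run_append, (h L hL).1], fun A B hA hD => by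
    simpa only [List.append_assoc] using
      (h L hL).2 A (F ++ B) hA (by simpa only [List.append_assoc] using hD)⟩

/-- If `C` does not fit on the given strands, the whole is no link and there is nothing to show.
Otherwise counting legs bounds below the number of strands above `C`. -/
theorem append_left (h : LocallyIsotopic n' D E) (C : SlicedDiagram)
    (hn : n' ≤ n + (C.map outs).sum - (C.map ins).sum) :
    LocallyIsotopic n (C ++ D) (C ++ E) := fun L hL => by
  rw [run_append, run_append]
  rcases hC : run C L with _ | M
  · refine ⟨rfl, fun A B hA hD => ?_⟩
    rw [isLink_iff, ← List.append_assoc, run_append, run_append, run_append, hA,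
      Option.bind_some, hC] at hD
    cases hD
  · have hM := length_run hC
    have h' := h M (by omega)
    refine ⟨h'.1, fun A B hA hD => ?_⟩
    have hAC : run (A ++ C) [] = some M := by rw [run_append, hA, Option.bind_some, hC]
    simpa only [List.append_assoc] using
      h'.2 (A ++ C) B hAC (by simpa only [List.append_assoc] using hD)

theorem append_left_zero (h : LocallyIsotopic 0 D E) (C : SlicedDiagram) :
    LocallyIsotopic n (C ++ D) (C ++ E) :=
  h.append_left C (Nat.zero_le _)

theorem isotopic (h : LocallyIsotopic 0 D E) (hD : D.IsLink) : Isotopic D E := by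
  simpa using (h [] le_rfl).2 [] [] rfl (by simpa using hD)

theorem of_move (h : Move D E) (hrun : ∀ L : List Bool, n ≤ L.length → run D L = run E L) :
    LocallyIsotopic n D E := fun L hL =>
  ⟨hrun L hL, fun A B hA hD =>
    .rel _ _ ⟨A, B, D, E, h, rfl, rfl, hD, (isLink_congr hA (hrun L hL)).1 hD⟩⟩

/-- Lowering both slices together reduces to `s` at place `0`. Then the slice on the right, before
or after the exchange, is raised twice and leaves the first two strands alone. -/
theorem run_far (s t : Slice) (h : s.place + s.outs ≤ t.place) (L : List Bool) :
    run [s, t] L = run [t.moveTo (t.place + s.ins - s.outs), s] L := by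
  obtain ⟨p, hp⟩ : ∃ p, s.place = p := ⟨_, rfl⟩
  induction p generalizing s t L with
  | succ p ih =>
    have hs : (s.moveTo p).up = s := by
      rw [up, place_moveTo, moveTo_moveTo, ← hp, moveTo_place]
    have ht : (t.moveTo (t.place - 1)).up = t := by
      rw [up, place_moveTo, moveTo_moveTo, Nat.sub_add_cancel (by omega), moveTo_place]
    have := run_map_up_congr (by simp) (by simp) (ih (s.moveTo p) (t.moveTo (t.place - 1))
      (by simp only [place_moveTo, outs_moveTo]; omega) · (place_moveTo _ _)) L
    simp only [List.map_cons, List.map_nil, hs, ht] at this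
    rw [this]
    congr 2
    rw [up, place_moveTo, moveTo_moveTo, moveTo_moveTo]
    congr 1
    simp only [place_moveTo, outs_moveTo, ins_moveTo]
    omega
  | zero =>
    have key (u : Slice) : u.up.up = u.moveTo (u.place + 2) := by
      rw [up, up, place_moveTo, moveTo_moveTo]
    have ht (h : 2 ≤ t.place) : t = (t.moveTo (t.place - 2)).up.up := by
      rw [key, place_moveTo, moveTo_moveTo, Nat.sub_add_cancel h, moveTo_place]
    cases s with
    | cup i d =>
      obtain rfl : i = 0 := hp
      have h2 : 2 ≤ t.place := by simpa [place, outs] using h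
      simp only [ins, outs, add_zero]
      rw [run_cons, run_cons]
      nth_rw 1 [ht h2]
      simp only [run_cup_zero, Option.bind_some, run_cons, run_up_cons]
      cases (t.moveTo (t.place - 2)).run L <;> rfl
    | cap i =>
      obtain rfl : i = 0 := hp
      simp only [ins, outs, Nat.sub_zero]
      rw [run_cons, run_cons, ← key]
      rcases L with _ | ⟨x, _ | ⟨y, L⟩⟩
      · simp [run_cap_zero_nil, run_up_nil]
      · simp [run_cap_zero_singleton, run_up_cons, run_up_nil]
      · simp only [run_cap_zero, run_up_cons]
        split_ifs with hxy
        · simp only [Option.bind_some, run_cons]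
          cases t.run L <;> simp [run_cap_zero, hxy]
        · cases t.run L <;> simp [run_cons, run_cap_zero, hxy]
    | cross i b =>
      obtain rfl : i = 0 := hp
      have h2 : 2 ≤ t.place := by simpa [place, outs] using h
      simp only [ins, outs, Nat.add_sub_cancel, moveTo_place]
      rw [run_cons, run_cons, ht h2]
      generalize t.moveTo (t.place - 2) = u
      rcases L with _ | ⟨x, _ | ⟨y, L⟩⟩
      · simp [run_cross_zero_nil, run_up_nil]
      · simp [run_cross_zero_singleton, run_up_cons, run_up_nil]
      · simp only [run_cross_zero, run_up_cons, run_cons, Option.bind_some]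
        cases u.run L <;> rfl

theorem far (s t : Slice) (h : s.place + s.outs ≤ t.place) :
    LocallyIsotopic n [s, t] [t.moveTo (t.place + s.ins - s.outs), s] :=
  of_move (.far s t h) fun L _ => run_far s t h L

theorem slide_cup (i : ℕ) (d b : Bool) :
    LocallyIsotopic n [.cup i d, .cross (i + 1) b] [.cup (i + 1) d, .cross i (!b)] := by
  refine of_move (.slide_cup i d b) fun L hL => ?_
  clear hL
  induction i generalizing L with
  | zero => rcases L with _ | ⟨x, L⟩ <;> simp [run_cons, Slice.run]
  | succ i ih =>
    exact run_map_up_congr (by simp) (by simp) ih L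

theorem slide_cap (i : ℕ) (b : Bool) :
    LocallyIsotopic n [.cross i b, .cap (i + 1)] [.cross (i + 1) (!b), .cap i] := by
  refine of_move (.slide_cap i b) fun L hL => ?_
  clear hL
  induction i generalizing L with
  | zero =>
    rcases L with _ | ⟨x, _ | ⟨y, _ | ⟨z, L⟩⟩⟩ <;> simp [run_cons, Slice.run]
  | succ i ih =>
    exact run_map_up_congr (by simp) (by simp) ih L

theorem R3 (i : ℕ) (b : Bool) :
    LocallyIsotopic n [.cross i b, .cross (i + 1) b, .cross i b]
      [.cross (i + 1) b, .cross i b, .cross (i + 1) b] := by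
  refine of_move (.R3 i b) fun L hL => ?_
  clear hL
  induction i generalizing L with
  | zero =>
    rcases L with _ | ⟨x, _ | ⟨y, _ | ⟨z, L⟩⟩⟩ <;> simp [run_cons, Slice.run]
  | succ i ih =>
    exact run_map_up_congr (by simp) (by simp) ih L

/-- The bound is essential: with fewer strands the crossings do not fit, but the empty diagram does.
-/
theorem R2 (i : ℕ) (b : Bool) :
    LocallyIsotopic (i + 2) [.cross i b, .cross i (!b)] [] := by
  refine of_move (.R2 i b) fun L hL => ?_
  induction i generalizing L with
  | zero =>
    rcases L with _ | ⟨x, _ | ⟨y, L⟩⟩ <;> simp [run_cons, Slice.run] at *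
  | succ i ih =>
    obtain ⟨x, L, rfl⟩ := List.exists_cons_of_length_pos (by omega : 0 < L.length)
    have := run_map_up_cons [.cross i b, .cross i (!b)] x L
    rw [ih L (by simpa using hL)] at this
    exact this

/-- A crossing commutes with a slice that is further to the right. -/
theorem cross_comm (i : ℕ) (b : Bool) (t : Slice) (h : i + 2 ≤ t.place) :
    LocallyIsotopic n [.cross i b, t] [t, .cross i b] := by
  simpa [ins, outs, moveTo_place] using far (n := n) (.cross i b) t h

end LocallyIsotopic

end SlicedDiagram

/-! ### Crossings next to nested minima and maxima -/

namespace SlicedDiagram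

open Slice

/-- `m` nested minima whose left legs are directed upwards. -/
def cups (m : ℕ) : SlicedDiagram := (List.range m).map fun i => .cup i true

/-- `m` nested maxima. -/
def caps (m : ℕ) : SlicedDiagram := (List.range m).reverse.map .cap

theorem cups_succ (m : ℕ) : cups (m + 1) = cups m ++ [.cup m true] := by
  simp [cups, List.range_succ]

theorem caps_succ (m : ℕ) : caps (m + 1) = .cap m :: caps m := by
  simp [caps, List.range_succ]

theorem sum_outs_cups (m : ℕ) : ((cups m).map outs).sum = 2 * m := by
  induction m with
  | zero => rfl
  | succ m ih => simp [cups_succ, ih, outs]; ring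

theorem sum_ins_cups (m : ℕ) : ((cups m).map ins).sum = 0 := by
  induction m with
  | zero => rfl
  | succ m ih => simp [cups_succ, ih, ins]

namespace LocallyIsotopic

variable {n : ℕ} {D E : SlicedDiagram}

theorem cups_append {m : ℕ} (h : LocallyIsotopic (2 * m) D E) :
    LocallyIsotopic n (cups m ++ D) (cups m ++ E) :=
  h.append_left _ (by rw [sum_outs_cups, sum_ins_cups]; omega)

/-- A crossing next to nested minima is moved from their left legs to their right legs. -/
theorem cups_cross (i r : ℕ) (b : Bool) :
    LocallyIsotopic 0 (cups (i + 2 + r) ++ [.cross i b])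
      (cups (i + 2 + r) ++ [.cross (i + 2 + 2 * r) b]) := by
  induction r with
  | zero =>
    simp only [add_zero, mul_zero, cups_succ, List.append_assoc, List.cons_append,
      List.nil_append]
    refine append_left_zero ?_ _
    -- Sliding across the innermost minimum from either side leads to the same crossing at `i + 1`
    -- with its sign changed, up to the heights of the two minima.
    have hfar : LocallyIsotopic 0 [.cup i true, .cup (i + 2) true] [.cup i true, .cup i true] :=
      far (.cup i true) (.cup (i + 2) true) le_rfl
    have h1 : LocallyIsotopic 0 [.cup i true, .cup (i + 1) true, .cross i b]
        [.cup i true, .cup i true, .cross (i + 1) (!b)] := by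
      simpa using (slide_cup i true (!b)).symm.append_left_zero [.cup i true]
    have h2 : LocallyIsotopic 0 [.cup i true, .cup (i + 1) true, .cross (i + 2) b]
        [.cup i true, .cup (i + 2) true, .cross (i + 1) (!b)] :=
      (slide_cup (i + 1) true b).append_left_zero [.cup i true]
    exact h1.trans ((h2.trans (hfar.append_right _)).symm)
  | succ r ih =>
    rw [← add_assoc, cups_succ, List.append_assoc, List.append_assoc]
    have h1 : LocallyIsotopic 0 [.cross i b, .cup (i + 2 + r) true]
        [.cup (i + 2 + r) true, .cross i b] := cross_comm i b _ (by simp [place])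
    have h2 : LocallyIsotopic 0 [.cup (i + 2 + r) true, .cross (i + 2 + 2 * (r + 1)) b]
        [.cross (i + 2 + 2 * r) b, .cup (i + 2 + r) true] :=
      far (.cup (i + 2 + r) true) (.cross (i + 2 + 2 * (r + 1)) b)
        (by simp only [place, outs]; omega)
    refine (h1.symm.append_left_zero _).trans (.trans ?_ (h2.symm.append_left_zero _))
    simpa using ih.append_right [.cup (i + 2 + r) true]

/-- A crossing next to nested maxima is moved from their left legs to their right legs. -/
theorem cross_caps (i r : ℕ) (b : Bool) :
    LocallyIsotopic 0 (.cross i b :: caps (i + 2 + r))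
      (.cross (i + 2 + 2 * r) b :: caps (i + 2 + r)) := by
  induction r with
  | zero =>
    simp only [add_zero, mul_zero, caps_succ]
    have hfar : LocallyIsotopic 0 [.cap i, .cap i] [.cap (i + 2), .cap i] :=
      far (.cap i) (.cap i) le_rfl
    have h1 : LocallyIsotopic 0 [.cross i b, .cap (i + 1), .cap i]
        [.cross (i + 1) (!b), .cap i, .cap i] :=
      (slide_cap i b).append_right [.cap i]
    have h2 : LocallyIsotopic 0 [.cross (i + 2) b, .cap (i + 1), .cap i]
        [.cross (i + 1) (!b), .cap (i + 2), .cap i] := by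
      simpa using (slide_cap (i + 1) (!b)).symm.append_right [.cap i]
    have h3 : LocallyIsotopic 0 [.cross (i + 1) (!b), .cap i, .cap i]
        [.cross (i + 1) (!b), .cap (i + 2), .cap i] :=
      (far (.cap i) (.cap i) le_rfl).append_left_zero [.cross (i + 1) (!b)]
    exact (h1.trans (h3.trans h2.symm)).append_right (caps i)
  | succ r ih =>
    rw [← add_assoc, caps_succ]
    have h1 : LocallyIsotopic 0 [.cross i b, .cap (i + 2 + r)]
        [.cap (i + 2 + r), .cross i b] := cross_comm i b _ (by simp [place])
    have h2 : LocallyIsotopic 0 [.cap (i + 2 + r), .cross (i + 2 + 2 * r) b]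
        [.cross (i + 2 + 2 * (r + 1)) b, .cap (i + 2 + r)] :=
      far (.cap (i + 2 + r)) (.cross (i + 2 + 2 * r) b) (by simp only [place, outs]; omega)
    exact (h1.append_right _).trans
      (.trans (ih.append_left_zero [.cap (i + 2 + r)]) (h2.append_right _))

end LocallyIsotopic

end SlicedDiagram

/-! ### Closures of braid words -/

namespace BraidWord

open SlicedDiagram BraidGroup

variable {m k : ℕ}

/-- The crossings of a braid word. -/
def crosses (w : BraidWord m) : SlicedDiagram := w.map fun x => .cross x.1 x.2

theorem crosses_cons (x : Fin (m - 1) × Bool) (w : BraidWord m) :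
    crosses (x :: w) = .cross x.1 x.2 :: w.crosses := rfl

theorem crosses_append (w v : BraidWord m) : crosses (w ++ v) = w.crosses ++ v.crosses :=
  List.map_append

theorem closure_eq (w : BraidWord m) : w.closure = cups m ++ w.crosses ++ caps m := rfl

/-- Cancellation is the second Reidemeister move, far commutation a change of heights, and the braid
relation the third Reidemeister move. -/
theorem locallyIsotopic_crosses {w v : BraidWord m} (h : w.toBraid = v.toBraid) :
    LocallyIsotopic m w.crosses v.crosses := by
  refine rel_of_toBraid_eq
    (r := fun w v => LocallyIsotopic m (BraidWord.crosses w) (BraidWord.crosses v))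
    ⟨fun _ => .refl _ _, .symm, .trans⟩ ?_ ?_ ?_ ?_ h
  · intro x w v h
    exact h.append_left [.cross x.1 x.2] (by simp [Slice.ins, Slice.outs])
  · intro i b w
    exact ((LocallyIsotopic.R2 i b).mono (by have := i.isLt; omega)).append_right (crosses w)
  · intro i j hij w
    exact (LocallyIsotopic.cross_comm i true (.cross j true) hij).append_right (crosses w)
  · intro i j hij w
    have := (LocallyIsotopic.R3 (n := m) i true).append_right (crosses w)
    rw [hij] at this
    exact this

theorem run_crosses (w : BraidWord m) (L : List Bool) :
    run w.crosses (List.replicate m true ++ L) = some (List.replicate m true ++ L) := by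
  induction w with
  | nil => rfl
  | cons x w ih =>
    obtain ⟨⟨i, hi⟩, b⟩ := x
    obtain ⟨r, rfl⟩ : ∃ r, m = i + (r + 2) := ⟨m - 2 - i, by omega⟩
    have : (Slice.cross i b).run (List.replicate (i + (r + 2)) true ++ L) =
        some (List.replicate (i + (r + 2)) true ++ L) := by
      simp [Slice.run, List.replicate_add i, List.replicate_succ]
    rw [crosses_cons, run_cons, this, Option.bind_some, ih]

theorem run_cups (m : ℕ) :
    run (cups m) [] = some (List.replicate m true ++ List.replicate m false) := by
  induction m with
  | zero => rfl
  | succ m ih =>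
    rw [cups_succ, run_append, ih, Option.bind_some, run_cons]
    simp [Slice.run, List.replicate_succ' (n := m) (a := true), List.replicate_succ (n := m)]

theorem run_caps (m : ℕ) :
    run (caps m) (List.replicate m true ++ List.replicate m false) = some [] := by
  induction m with
  | zero => rfl
  | succ m ih =>
    rw [caps_succ, run_cons]
    have : (Slice.cap m).run (List.replicate (m + 1) true ++ List.replicate (m + 1) false) =
        some (List.replicate m true ++ List.replicate m false) := by
      simp [Slice.run, List.replicate_succ' (n := m) (a := true), List.replicate_succ (n := m)]
    rw [this, Option.bind_some, ih]

theorem isLink_closure (w : BraidWord m) : w.closure.IsLink := by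
  rw [isLink_iff, closure_eq, run_append, run_append, run_cups, Option.bind_some, run_crosses,
    Option.bind_some, run_caps]

theorem closure_locallyIsotopic {w v : BraidWord m} (h : w.toBraid = v.toBraid) :
    LocallyIsotopic 0 w.closure v.closure := by
  rw [closure_eq, closure_eq]
  exact (LocallyIsotopic.cups_append
    ((locallyIsotopic_crosses h).mono (by omega))).append_right _

theorem crosses_comm (w : BraidWord k) (s : Slice) (hs : k ≤ s.place) :
    LocallyIsotopic 0 (w.crosses ++ [s]) (s :: w.crosses) := by
  induction w with
  | nil => exact .refl _ _
  | cons x w ih =>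
    exact (ih.append_left_zero [.cross x.1 x.2]).trans
      ((LocallyIsotopic.cross_comm x.1 x.2 s (by omega)).append_right (crosses w))

theorem closure_cons (x : Fin (m - 1) × Bool) (w : BraidWord m) :
    LocallyIsotopic 0 (BraidWord.closure (x :: w)) (BraidWord.closure (w ++ [x])) := by
  obtain ⟨⟨i, hi⟩, b⟩ := x
  obtain ⟨r, hr⟩ : ∃ r, m = i + 2 + r := ⟨m - (i + 2), by omega⟩
  -- The first crossing goes through the minima to the right legs, rises there past `w`, and returns
  -- over the maxima to the end of the braid.
  have h1 := (LocallyIsotopic.cups_cross i r b).append_right (w.crosses ++ caps m)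
  have h2 := (LocallyIsotopic.cross_caps i r b).append_left_zero (n := 0)
    (cups m ++ w.crosses)
  rw [← hr] at h1 h2
  have h3 := ((crosses_comm w (.cross (i + 2 + 2 * r) b)
    (by simp only [Slice.place]; omega)).append_right (caps m)).append_left_zero (n := 0) (cups m)
  rw [closure_eq, closure_eq, crosses_append]
  simp only [crosses_cons, List.append_assoc, List.cons_append, List.nil_append] at h1 h2 h3 ⊢
  exact h1.trans (h3.symm.trans h2.symm)

theorem closure_append_comm (w v : BraidWord m) :
    LocallyIsotopic 0 (BraidWord.closure (w ++ v)) (BraidWord.closure (v ++ w)) := by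
  induction w generalizing v with
  | nil => rw [List.append_nil]; exact .refl _ _
  | cons x w ih =>
    refine (closure_cons x (w ++ v)).trans ?_
    rw [List.append_assoc]
    simpa using ih (v ++ [x])

/-- Closures of conjugate braids are isotopic. -/
theorem closure_of_isConj {w v : BraidWord m} (h : IsConj w.toBraid v.toBraid) :
    LocallyIsotopic 0 w.closure v.closure := by
  obtain ⟨γ, hγ⟩ := isConj_iff.1 h
  obtain ⟨u, rfl⟩ := exists_toBraid_eq γ
  obtain ⟨u', hu'⟩ := exists_toBraid_eq u.toBraid⁻¹
  have h1 : w.toBraid = BraidWord.toBraid ((w ++ u') ++ u) := by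
    rw [toBraid_append, toBraid_append, hu', inv_mul_cancel_right]
  have h2 : BraidWord.toBraid (u ++ (w ++ u')) = v.toBraid := by
    rw [toBraid_append, toBraid_append, hu', ← hγ, mul_assoc]
  exact (closure_locallyIsotopic h1).trans
    ((closure_append_comm _ _).trans (closure_locallyIsotopic h2))

end BraidWord

/-! ### Split circles -/

namespace SlicedDiagram

open Slice

namespace LocallyIsotopic

variable {n : ℕ}

/-- A circle is moved across a strand. -/
theorem circle_pass (i : ℕ) (d : Bool) :
    LocallyIsotopic (i + 1) [.cup (i + 1) d, .cap (i + 1)] [.cup i d, .cap i] := by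
  -- The left leg of the circle is pushed across the strand, creating two crossings. Sliding the
  -- minimum and the maximum across makes them crossings with the right leg, which cancel.
  have h1 : LocallyIsotopic (i + 1) [.cup (i + 1) d, .cap (i + 1)]
      [.cup (i + 1) d, .cross i true, .cross i false, .cap (i + 1)] :=
    ((R2 i true).append_right [.cap (i + 1)]).symm.append_left [.cup (i + 1) d]
      (by simp [ins, outs])
  have h2 : LocallyIsotopic (i + 1) [.cup (i + 1) d, .cross i true, .cross i false, .cap (i + 1)]
      [.cup i d, .cross (i + 1) false, .cross i false, .cap (i + 1)] :=
    (slide_cup i d false).symm.append_right [.cross i false, .cap (i + 1)]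
  have h3 : LocallyIsotopic (i + 1)
      [.cup i d, .cross (i + 1) false, .cross i false, .cap (i + 1)]
      [.cup i d, .cross (i + 1) false, .cross (i + 1) true, .cap i] :=
    (slide_cap i false).append_left_zero [.cup i d, .cross (i + 1) false]
  have h4 : LocallyIsotopic (i + 1)
      [.cup i d, .cross (i + 1) false, .cross (i + 1) true, .cap i] [.cup i d, .cap i] :=
    ((R2 (i + 1) false).append_right [.cap i]).append_left [.cup i d] (by simp [ins, outs])
  exact h1.trans (h2.trans (h3.trans h4))

theorem circle_to_left (i : ℕ) (d : Bool) :
    LocallyIsotopic i [.cup i d, .cap i] [.cup 0 d, .cap 0] := by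
  induction i with
  | zero => exact refl _ _
  | succ i ih => exact (circle_pass i d).trans (ih.mono i.le_succ)

/-- Each slice exchanges heights with the maximum and then with the minimum; between the two it lies
two places further to the right. -/
theorem circle_comm (d : Bool) (D : SlicedDiagram) :
    LocallyIsotopic 0 ([.cup 0 d, .cap 0] ++ D) (D ++ [.cup 0 d, .cap 0]) := by
  induction D with
  | nil => exact refl _ _
  | cons s D ih =>
    have h1 : LocallyIsotopic 0 [.cup 0 d, .cap 0, s]
        [.cup 0 d, s.moveTo (s.place + 2), .cap 0] :=
      (far (n := 0) (.cap 0) s (Nat.zero_le _)).append_left_zero [.cup 0 d]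
    have h2 : LocallyIsotopic 0 [.cup 0 d, s.moveTo (s.place + 2)] [s, .cup 0 d] := by
      have := far (n := 0) (.cup 0 d) (s.moveTo (s.place + 2)) (by rw [place_moveTo]; exact Nat.le_add_left 2 _)
      simpa [ins, outs, moveTo_moveTo, moveTo_place] using this
    exact ((h1.trans (h2.append_right [.cap 0])).append_right D).trans
      (ih.append_left_zero [s])

end LocallyIsotopic

theorem circles_succ (n : ℕ) : circles (n + 1) = circles n ++ [.cup 0 true, .cap 0] := by
  simp [circles, List.replicate_succ']

end SlicedDiagram

namespace BraidWord

open SlicedDiagram BraidGroup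

variable {k : ℕ}

/-- Strands that are not braided close up to split circles. -/
theorem cups_crosses_caps (v : BraidWord k) (n : ℕ) :
    LocallyIsotopic 0 (cups (k + n) ++ v.crosses ++ caps (k + n))
      (v.closure ++ circles n) := by
  induction n with
  | zero => simpa [circles, closure_eq] using LocallyIsotopic.refl 0 v.closure
  | succ n ih =>
    rw [← add_assoc, cups_succ, caps_succ, circles_succ]
    -- The innermost minimum rises past the braid until it meets the innermost maximum. The
    -- resulting circle is moved to the far left, then above the remaining maxima.
    have h1 : LocallyIsotopic 0
        (cups (k + n) ++ ([.cup (k + n) true] ++ v.crosses) ++ .cap (k + n) :: caps (k + n))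
        (cups (k + n) ++ (v.crosses ++ [.cup (k + n) true]) ++ .cap (k + n) :: caps (k + n)) :=
      ((crosses_comm v (.cup (k + n) true)
        (by simp [Slice.place])).symm.append_left_zero _).append_right _
    have h2 : LocallyIsotopic 0
        (cups (k + n) ++ v.crosses ++ ([.cup (k + n) true, .cap (k + n)] ++ caps (k + n)))
        (cups (k + n) ++ v.crosses ++ ([.cup 0 true, .cap 0] ++ caps (k + n))) := by
      rw [List.append_assoc, List.append_assoc]
      refine LocallyIsotopic.cups_append ?_
      refine LocallyIsotopic.append_left
        ((LocallyIsotopic.circle_to_left (k + n) true).append_right _) _ ?_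
      have : (v.crosses.map Slice.outs).sum = (v.crosses.map Slice.ins).sum := by
        simp [crosses, Function.comp_def, Slice.ins, Slice.outs]
      omega
    have h3 := (LocallyIsotopic.circle_comm true (caps (k + n))).append_left_zero (n := 0)
      (cups (k + n) ++ v.crosses)
    have h4 := ih.append_right [.cup 0 true, .cap 0]
    simp only [List.append_assoc, List.cons_append, List.nil_append] at h1 h2 h3 h4 ⊢
    exact h1.trans (h2.trans (h3.trans h4))

/-- Slices forget the number of strands of the braid, so at position `0` the embedding does not
change the crossings. -/
theorem crosses_shift_zero {m : ℕ} (h : 0 + k ≤ m) (v : BraidWord k) :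
    (shift h v).crosses = v.crosses := by
  simp [shift, crosses, Function.comp_def]

/-- The closure of a braid that is conjugate to a braid on `k` consecutive strands. -/
theorem closure_isotopic_of_isConj_embed {m p : ℕ} (h : p + k ≤ m) {w : BraidWord m}
    {v : BraidWord k} (hw : IsConj (embed k m p h v.toBraid) w.toBraid) :
    w.closure.Isotopic (v.closure ++ circles (m - k)) := by
  obtain ⟨n, rfl⟩ : ∃ n, m = k + n := ⟨m - k, by omega⟩
  have h0 : 0 + k ≤ k + n := by omega
  have hc : IsConj w.toBraid (shift h0 v).toBraid := by
    rw [toBraid_shift]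
    exact hw.symm.trans (isConj_embed_zero p h _).symm
  refine LocallyIsotopic.isotopic ((closure_of_isConj hc).trans ?_) (isLink_closure w)
  rw [closure_eq, crosses_shift_zero, Nat.add_sub_cancel_left]
  exact cups_crosses_caps v n

end BraidWord

/-! ### The braid contributed by a singularity -/

namespace MonodromyProcess

open BraidGroup BraidWord

variable {m : ℕ} {X : Singularity} (P : MonodromyProcess m) (j : ℕ) (s : Stage m X)

theorem contribution_eq : P.contribution j s =
    (P.conjugator j)⁻¹ * embed X.strands m s.pos s.fits X.braid * P.conjugator j := by
  have := map_list_prod ((MulAut.conj (P.conjugator j)⁻¹).toMonoidHom.comp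
    (embed X.strands m s.pos s.fits)) X.factors
  simp only [MonoidHom.comp_apply, MulEquiv.coe_toMonoidHom, MulAut.conj_apply,
    inv_inv] at this
  rw [contribution, resultingFactors, Singularity.braid, this]
  exact congrArg List.prod (List.map_congr_left fun β _ => by simp)

theorem isConj_contribution :
    IsConj (embed X.strands m s.pos s.fits X.braid) (P.contribution j s) :=
  isConj_iff.2 ⟨(P.conjugator j)⁻¹, by rw [contribution_eq, inv_inv]⟩

variable {P j s}

theorem globalIndex_eq {u : BraidWord m} (hu : u.toBraid = P.conjugator j) (q : Fin X.strands) :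
    P.globalIndex j s q = u.move (shiftPos s.fits q) := by
  rw [move_eq, hu]; rfl

theorem globalStrands_eq {u : BraidWord m} (hu : u.toBraid = P.conjugator j) :
    (Finset.univ.map (shiftPos s.fits)).map u.move.toEmbedding = P.globalStrands j s := by
  rw [Finset.map_map, move_eq, hu]; rfl

theorem exists_move_eq_of_notMem {u : BraidWord m} (hu : u.toBraid = P.conjugator j) {a : Fin m}
    (ha : a ∉ P.globalStrands j s) :
    ∃ x ∉ Finset.univ.map (shiftPos s.fits), u.move x = a := by
  refine ⟨u.move.symm a, fun h => ha ?_, Equiv.apply_symm_apply _ _⟩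
  rw [← globalStrands_eq hu]
  simpa using Finset.mem_map_of_mem u.move.toEmbedding h

theorem toBraid_eq_conj_shift {w u : BraidWord m} {v : BraidWord X.strands}
    (hw : w.toBraid = P.contribution j s) (hu : u.toBraid = P.conjugator j)
    (hv : v.toBraid = X.braid) :
    w.toBraid = u.toBraid⁻¹ * (shift s.fits v).toBraid * u.toBraid := by
  rw [toBraid_shift, hv, hu, hw, contribution_eq]

theorem move_eq_conj {w u : BraidWord m} {v : BraidWord X.strands}
    (hw : w.toBraid = P.contribution j s) (hu : u.toBraid = P.conjugator j)
    (hv : v.toBraid = X.braid) : w.move = u.move * (shift s.fits v).move * u.move⁻¹ := by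
  rw [move_eq w, toBraid_eq_conj_shift hw hu hv, map_mul, map_mul, map_inv, move_eq, move_eq]
  group

theorem toBraid_restrict_globalStrands {w u : BraidWord m} (hw : w.toBraid = P.contribution j s)
    (hu : u.toBraid = P.conjugator j) :
    (w.restrict (P.globalStrands j s) (P.card_globalStrands j s)).toBraid =
      (u.restrict s.localStrands s.card_localStrands).toBraid⁻¹ * X.braid *
        (u.restrict s.localStrands s.card_localStrands).toBraid := by
  obtain ⟨v, hv⟩ := exists_toBraid_eq X.braid
  have hcard : (Finset.univ.map (shiftPos s.fits)).card = X.strands := by simp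
  have := toBraid_restrict_conj (toBraid_eq_conj_shift hw hu hv) (map_move_shift s.fits v)
    (globalStrands_eq hu) hcard (P.card_globalStrands j s)
  rw [restrict_shift, hv] at this
  exact this

theorem toBraid_restrict_compl_globalStrands {w : BraidWord m}
    (hw : w.toBraid = P.contribution j s) :
    (w.restrict (P.globalStrands j s)ᶜ (P.card_compl_globalStrands j s)).toBraid = 1 := by
  obtain ⟨v, hv⟩ := exists_toBraid_eq X.braid
  obtain ⟨u, hu⟩ := exists_toBraid_eq (P.conjugator j)
  have hcard : (Finset.univ.map (shiftPos s.fits))ᶜ.card = m - X.strands := by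
    simp [Finset.card_compl]
  rw [toBraid_restrict_conj (toBraid_eq_conj_shift hw hu hv)
    (by rw [map_compl, map_move_shift]) (by rw [map_compl, globalStrands_eq hu]) hcard,
    restrict_shift_compl]
  simp

theorem linkingNumber_globalIndex {w : BraidWord m} {v : BraidWord X.strands}
    (hw : w.toBraid = P.contribution j s) (hv : v.toBraid = X.braid) (q r : Fin X.strands) :
    w.linkingNumber (P.globalIndex j s q) (P.globalIndex j s r) = v.linkingNumber q r := by
  obtain ⟨u, hu⟩ := exists_toBraid_eq (P.conjugator j)
  rw [globalIndex_eq hu, globalIndex_eq hu, linkingNumber_conj (toBraid_eq_conj_shift hw hu hv),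
    linkingNumber_shift]

theorem linkingNumber_of_notMem {w : BraidWord m} (hw : w.toBraid = P.contribution j s)
    {a : Fin m} (ha : a ∉ P.globalStrands j s) (b : Fin m) : w.linkingNumber a b = 0 := by
  obtain ⟨v, hv⟩ := exists_toBraid_eq X.braid
  obtain ⟨u, hu⟩ := exists_toBraid_eq (P.conjugator j)
  obtain ⟨x, hx, rfl⟩ := exists_move_eq_of_notMem hu ha
  obtain ⟨y, rfl⟩ := u.move.surjective b
  rw [linkingNumber_conj (toBraid_eq_conj_shift hw hu hv), linkingNumber_shift_of_notMem _ v hx]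

theorem strandPerm_contribution_of_notMem {a : Fin m} (ha : a ∉ P.globalStrands j s) :
    strandPerm m (P.contribution j s) a = a := by
  obtain ⟨w, hw⟩ := exists_toBraid_eq (P.contribution j s)
  obtain ⟨v, hv⟩ := exists_toBraid_eq X.braid
  obtain ⟨u, hu⟩ := exists_toBraid_eq (P.conjugator j)
  obtain ⟨x, hx, rfl⟩ := exists_move_eq_of_notMem hu ha
  rw [← hw, ← inv_inv (strandPerm m w.toBraid), ← move_eq, Equiv.Perm.inv_eq_iff_eq,
    move_eq_conj hw hu hv]
  simp [move_shift_of_notMem s.fits v hx]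

theorem sameCycle_globalIndex (q r : Fin X.strands) :
    (strandPerm m (P.contribution j s)).SameCycle
        (P.globalIndex j s q) (P.globalIndex j s r) ↔
      (strandPerm X.strands X.braid).SameCycle q r := by
  obtain ⟨w, hw⟩ := exists_toBraid_eq (P.contribution j s)
  obtain ⟨v, hv⟩ := exists_toBraid_eq X.braid
  obtain ⟨u, hu⟩ := exists_toBraid_eq (P.conjugator j)
  rw [← hw, ← hv, sameCycle_iff_move, sameCycle_iff_move, move_eq_conj hw hu hv,
    Equiv.Perm.sameCycle_conj, globalIndex_eq hu, globalIndex_eq hu, ← sameCycle_shift s.fits]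
  simp

end MonodromyProcess

theorem mainTheorem10 {m : ℕ} (X : Singularity) (P P' : MonodromyProcess m) (j j' : ℕ)
    (s s' : Stage m X) (hs : P[j]? = some ⟨X, s⟩) (hs' : P'[j']? = some ⟨X, s'⟩) :
    -- the conjugated factors together form one conjugate of the local braid
    P.contribution j s =
      (P.conjugator j)⁻¹ * BraidGroup.embed X.strands m s.pos s.fits X.braid *
        P.conjugator j ∧
    -- the braids that result from any two positions in any two processes are conjugate
    IsConj (P.contribution j s) (P'.contribution j' s') ∧
    -- the strands with other indices return to their places and are not braided
    (∀ a ∉ P.globalStrands j s,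
      BraidGroup.strandPerm m (P.contribution j s) a = a) ∧
    (∀ w : BraidWord m, w.toBraid = P.contribution j s →
      (w.restrict (P.globalStrands j s)ᶜ (P.card_compl_globalStrands j s)).toBraid = 1) ∧
    -- on the indexed strands the resulting braid is the local braid, up to the conjugation by
    -- what the conjugator does to these strands; for two strands it is the local braid
    (∀ w u : BraidWord m, w.toBraid = P.contribution j s → u.toBraid = P.conjugator j →
      (w.restrict (P.globalStrands j s) (P.card_globalStrands j s)).toBraid =
        (u.restrict s.localStrands s.card_localStrands).toBraid⁻¹ * X.braid *
          (u.restrict s.localStrands s.card_localStrands).toBraid) ∧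
    (∀ w w' : BraidWord m, w.toBraid = P.contribution j s →
      w'.toBraid = P'.contribution j' s' →
      IsConj (w.restrict (P.globalStrands j s) (P.card_globalStrands j s)).toBraid
        (w'.restrict (P'.globalStrands j' s') (P'.card_globalStrands j' s')).toBraid) ∧
    (X.strands = 2 → ∀ w : BraidWord m, w.toBraid = P.contribution j s →
      (w.restrict (P.globalStrands j s) (P.card_globalStrands j s)).toBraid = X.braid) ∧
    -- the components of the closure that come from the indexed strands, and their linking
    -- numbers, are those of the closure of the local braid, and the same in both processes
    (∀ q r : Fin X.strands,
      (BraidGroup.strandPerm m (P.contribution j s)).SameCycle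
          (P.globalIndex j s q) (P.globalIndex j s r) ↔
        (BraidGroup.strandPerm X.strands X.braid).SameCycle q r) ∧
    (∀ (w : BraidWord m) (v : BraidWord X.strands), w.toBraid = P.contribution j s →
      v.toBraid = X.braid → ∀ q r : Fin X.strands,
        w.linkingNumber (P.globalIndex j s q) (P.globalIndex j s r) = v.linkingNumber q r) ∧
    (∀ w w' : BraidWord m, w.toBraid = P.contribution j s →
      w'.toBraid = P'.contribution j' s' → ∀ q r : Fin X.strands,
        w.linkingNumber (P.globalIndex j s q) (P.globalIndex j s r) =
          w'.linkingNumber (P'.globalIndex j' s' q) (P'.globalIndex j' s' r)) ∧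
    -- the components of the other strands have linking number zero with all components
    (∀ w : BraidWord m, w.toBraid = P.contribution j s →
      ∀ a ∉ P.globalStrands j s, ∀ b ≠ a, w.linkingNumber a b = 0) ∧
    -- the closure is the closure of the local braid, split from one unknotted circle for every
    -- other strand, and the closures in both processes are isotopic
    (∀ (w : BraidWord m) (v : BraidWord X.strands), w.toBraid = P.contribution j s →
      v.toBraid = X.braid →
        w.closure.Isotopic (v.closure ++ SlicedDiagram.circles (m - X.strands))) ∧
    (∀ w w' : BraidWord m, w.toBraid = P.contribution j s →
      w'.toBraid = P'.contribution j' s' → w.closure.Isotopic w'.closure) := by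
  have conj_local (P : MonodromyProcess m) (j : ℕ) (s : Stage m X) (w : BraidWord m)
      (hw : w.toBraid = P.contribution j s) : IsConj X.braid
        (w.restrict (P.globalStrands j s) (P.card_globalStrands j s)).toBraid := by
    obtain ⟨u, hu⟩ := BraidWord.exists_toBraid_eq (P.conjugator j)
    rw [MonodromyProcess.toBraid_restrict_globalStrands hw hu]
    exact isConj_iff.2 ⟨_, by rw [inv_inv]⟩
  have conj_contribution : IsConj (P.contribution j s) (P'.contribution j' s') :=
    (P.isConj_contribution j s).symm.trans
      ((BraidGroup.isConj_embed_zero _ _ _).symm.trans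
        ((BraidGroup.isConj_embed_zero _ _ _).trans (P'.isConj_contribution j' s')))
  refine ⟨P.contribution_eq j s, conj_contribution,
    fun a ha => MonodromyProcess.strandPerm_contribution_of_notMem ha,
    fun w hw => MonodromyProcess.toBraid_restrict_compl_globalStrands hw,
    fun w u hw hu => MonodromyProcess.toBraid_restrict_globalStrands hw hu,
    fun w w' hw hw' => (conj_local P j s w hw).symm.trans (conj_local P' j' s' w' hw'),
    fun h2 w hw => ?_,
    fun q r => MonodromyProcess.sameCycle_globalIndex q r,
    fun w v hw hv q r => MonodromyProcess.linkingNumber_globalIndex hw hv q r,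
    fun w w' hw hw' q r => ?_,
    fun w hw a ha b _ => MonodromyProcess.linkingNumber_of_notMem hw ha b,
    fun w v hw hv => ?_, fun w w' hw hw' => ?_⟩
  · obtain ⟨u, hu⟩ := BraidWord.exists_toBraid_eq (P.conjugator j)
    -- On two strands the conjugating braid commutes with the local one and cancels.
    rw [MonodromyProcess.toBraid_restrict_globalStrands hw hu, mul_assoc,
      BraidGroup.mul_comm_of_eq_two h2 X.braid, inv_mul_cancel_left]
  · obtain ⟨v, hv⟩ := BraidWord.exists_toBraid_eq X.braid
    rw [MonodromyProcess.linkingNumber_globalIndex hw hv,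
      MonodromyProcess.linkingNumber_globalIndex hw' hv]
  · refine BraidWord.closure_isotopic_of_isConj_embed s.fits ?_
    rw [hv, hw]
    exact P.isConj_contribution j s
  · refine (BraidWord.closure_of_isConj ?_).isotopic (BraidWord.isLink_closure w)
    rwa [hw, hw']
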